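/- Write $A\sim B$ if $cA\le B\le CA$ with universal constants $0<c\le C<\infty$. For $T,\lambda>0$ set $T_\lambda=T+\lambda^{-1}$. (Lagrangian energy.) For $\Phi,T,\lambda>0$ let $\mathcal C$ be the set of measurable families of curves $X:[0,T_\lambda]\times[-\frac{\Phi}{2},\frac{\Phi}{2}]\to\mathbb R$ with $X(0,x)=0$ and $X(T_\lambda,x)=x$ for every $x$, and $t\mapsto X(t,x)$ absolutely continuous for a.e. $x$. With $\phi_X(y,t)=|\{x\in[-\frac\Phi2,\frac\Phi2]: X(t,x)=y\}|$ and the convention $1/0=\infty$, set $$E(\Phi,T,\lambda)=\inf_{X\in\mathcal C}\left[\int_0^T\int_{-\Phi/2}^{\Phi/2}\frac{1}{\phi_X(X(t,x),t)}\,dx\,dt+\int_0^{T_\lambda}\int_{-\Phi/2}^{\Phi/2}|\partial_tX|^2\,dx\,dt\right].$$ (Eulerian energy.) Let $Q=\mathbb R/\mathbb Z$ and $Q_T=(-T,T)\times Q$. Let $\mathcal A_T^*$ be the set of positive finite measures $\mu=dt\otimes\mu_t$ on $Q_T$, with $\mu_t$ purely atomic for a.e. $t$, for which there is a finite real measure $m\ll\mu$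 with $\partial_t\mu+\partial_xm=0$ in the sense of distributions in $Q_T$. Set $$I(\mu)=\inf_{m}\left[\int_{-T}^T\#\{x\in Q:\mu_t(\{x\})>0\}\,dt+\int_{Q_T}\left|\frac{dm}{d\mu}\right|^2d\mu\right],$$ the infimum being over all such $m$, and $$\mathcal E^{1d}_{\lambda,T}(\mu)=I(\mu)+\lambda\left(W_{\rm per}^2(\mu_T,1)+W_{\rm per}^2(\mu_{-T},1)\right),$$ where $\mu_{\pm T}$ are the traces of $\mu$ at $t=\pm T$, i.e. the weak limits of $\mu_t$ as $t\to\pm T$ (up to a null set of times), $1$ is the Lebesgue measure on $Q$, and $W_{\rm per}$ is the quadratic Wasserstein distance for the distance $\min_{k\in\mathbb Z}|x-y-k|$ on $Q$ ($W_{\rm per}=\infty$ if the masses differ). **Proposition.** For every $\Phi,T,\lambda>0$, $$E(\Phi,T,\lambda)\sim T+\frac{\lambda\Phi^3}{1+\lambda T}.$$ As a consequence, for every $T,\lambda>0$, $$\inf_{\mu\in\mathcal A_T^*}\mathcal E^{1d}_{\lambda,T}(\mu)\sim T+\min\left(T^{1/3},\lambda^{1/3}T^{2/3}\right).$$ -/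

import Mathlib

open MeasureTheory ProbabilityTheory Set Filter Topology
open scoped ENNReal ContDiff

noncomputable section

/-! ## Irrigation of the Lebesgue measure from one Dirac mass (Lagrangian formulation) -/

/-- The effective time `T_λ = T + λ⁻¹`. -/
def effTime (T lam : ℝ) : ℝ := T + lam⁻¹

/-- The families of curves `X : [0, τ] × [-Φ/2, Φ/2] → ℝ` joining the single point `xbar` at
time `0` to the identity at time `τ`, such that almost every curve `t ↦ X t x` is absolutely
continuous. Values of `X` outside `[0, τ] × [-Φ/2, Φ/2]` are irrelevant. -/
structure IsIrrigation (Φ τ xbar : ℝ) (X : ℝ → ℝ → ℝ) : Prop where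
  aemeasurable : AEMeasurable (Function.uncurry X)
    (volume.restrict (Icc 0 τ ×ˢ Icc (-(Φ / 2)) (Φ / 2)))
  start : ∀ x ∈ Icc (-(Φ / 2)) (Φ / 2), X 0 x = xbar
  finish : ∀ x ∈ Icc (-(Φ / 2)) (Φ / 2), X τ x = x
  absCont : ∀ᵐ x ∂volume.restrict (Icc (-(Φ / 2)) (Φ / 2)),
    AbsolutelyContinuousOnInterval (fun t => X t x) 0 τ

/-- The multiplicity `φ_X(y, t) = |{x ∈ [-Φ/2, Φ/2] : X(t, x) = y}|`. -/
def curveMultiplicity (Φ : ℝ) (X : ℝ → ℝ → ℝ) (y t : ℝ) : ℝ≥0∞ :=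
  volume {x | x ∈ Icc (-(Φ / 2)) (Φ / 2) ∧ X t x = y}

/-- The Lagrangian energy
`∫₀ᵀ ∫ 1 / φ_X(X(t,x), t) dx dt + ∫₀^{T_λ} ∫ |∂ₜ X|² dx dt` over `x ∈ [-Φ/2, Φ/2]`, with the
convention `1 / 0 = ∞` (which is the one of `ℝ≥0∞`). The kinetic part is written as the integral
over `x` of the action of the curve `t ↦ X t x`. -/
def lagrangianEnergy (Φ T lam : ℝ) (X : ℝ → ℝ → ℝ) : ℝ≥0∞ :=
  (∫⁻ t in Ioo 0 T, ∫⁻ x in Icc (-(Φ / 2)) (Φ / 2), (curveMultiplicity Φ X (X t x) t)⁻¹) +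
    ∫⁻ x in Icc (-(Φ / 2)) (Φ / 2), ∫⁻ t in Ioo 0 (effTime T lam),
      ‖deriv (fun s => X s x) t‖ₑ ^ 2

/-- `E(Φ, T, λ, xbar)`: the least energy needed to irrigate the Lebesgue measure on
`[-Φ/2, Φ/2]` at time `T_λ` from a Dirac mass at `xbar` at time `0`. -/
def irrigationCostFrom (Φ T lam xbar : ℝ) : ℝ≥0∞ :=
  ⨅ (X : ℝ → ℝ → ℝ) (_ : IsIrrigation Φ (effTime T lam) xbar X), lagrangianEnergy Φ T lam X

/-- `E(Φ, T, λ) = E(Φ, T, λ, 0)`. -/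
def irrigationCost (Φ T lam : ℝ) : ℝ≥0∞ := irrigationCostFrom Φ T lam 0

/-! ## The energy with Wasserstein penalization on the circle `Q = ℝ / ℤ` (Eulerian formulation) -/

/-- The squared periodic Wasserstein distance `W_per²` on `Q = ℝ / ℤ`, as an infimum over
transport plans; `edist` on `UnitAddCircle` is the distance `min_{k ∈ ℤ} |x - y - k|`. It is `∞`
if the two masses differ. -/
def wassersteinPerSq (ν₀ ν₁ : Measure UnitAddCircle) : ℝ≥0∞ :=
  ⨅ (π : Measure (UnitAddCircle × UnitAddCircle)) (_ : π.fst = ν₀ ∧ π.snd = ν₁),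
    ∫⁻ p, edist p.1 p.2 ^ 2 ∂π

/-- The measure `dt ⊗ μ_t` on `Q_T = (-T, T) × Q`, viewed as a measure on `ℝ × Q`. -/
def spaceTimeMeasure (T : ℝ) (μ : Kernel ℝ UnitAddCircle) : Measure (ℝ × UnitAddCircle) :=
  (volume.restrict (Ioo (-T) T)) ⊗ₘ μ

/-- Smooth functions on `ℝ × Q` with compact support in `Q_T = (-T, T) × Q`. -/
structure IsTestFunction (T : ℝ) (ζ : ℝ → UnitAddCircle → ℝ) : Prop where
  smooth : ContDiff ℝ ∞ (fun p : ℝ × ℝ => ζ p.1 (p.2 : UnitAddCircle))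
  compactSupport : ∃ K ⊆ Ioo (-T) T, IsCompact K ∧ ∀ t ∉ K, ∀ x, ζ t x = 0

/-- The pair `(dt ⊗ μ_t, m)` belongs to the admissible class on `Q_T`. Here `m` is a finite real
measure absolutely continuous with respect to `dt ⊗ μ_t`, represented by its density
`v = dm / d(dt ⊗ μ_t)`, an integrable function. The continuity equation `∂ₜ μ + ∂ₓ m = 0` holds in
the sense of distributions, and `μ_t` is purely atomic for almost every `t`. -/
structure IsAdmissiblePair (T : ℝ) (μ : Kernel ℝ UnitAddCircle)
    (v : ℝ × UnitAddCircle → ℝ) : Prop where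
  finite : IsFiniteKernel μ
  integrable : Integrable v (spaceTimeMeasure T μ)
  continuityEq : ∀ ζ : ℝ → UnitAddCircle → ℝ, IsTestFunction T ζ →
    ∫ p, (deriv (fun s : ℝ => ζ s p.2) p.1
        + v p * deriv (fun h : ℝ => ζ p.1 (p.2 + (h : UnitAddCircle))) 0)
      ∂(spaceTimeMeasure T μ) = 0
  atomic : ∀ᵐ t ∂volume.restrict (Ioo (-T) T),
    ∃ S : Set UnitAddCircle, S.Countable ∧ μ t Sᶜ = 0

/-- The admissible measures: those for which some `m` makes the pair admissible. -/
def IsAdmissible (T : ℝ) (μ : Kernel ℝ UnitAddCircle) : Prop :=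
  ∃ v, IsAdmissiblePair T μ v

/-- The internal energy of a pair: the time integral of the number of atoms of `μ_t`
(i.e. of `∑_{x'} μ_t(x')⁰` over the atoms), plus `∫ |dm/dμ|² dμ`. -/
def pairEnergy (T : ℝ) (μ : Kernel ℝ UnitAddCircle) (v : ℝ × UnitAddCircle → ℝ) : ℝ≥0∞ :=
  (∫⁻ t in Ioo (-T) T, (({x | μ t {x} ≠ 0}.encard : ℕ∞) : ℝ≥0∞)) +
    ∫⁻ p, ‖v p‖ₑ ^ 2 ∂(spaceTimeMeasure T μ)

/-- The internal energy `I(μ)`: the least `I(μ, m)` over the admissible `m`. -/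
def internalEnergy (T : ℝ) (μ : Kernel ℝ UnitAddCircle) : ℝ≥0∞ :=
  ⨅ (v : ℝ × UnitAddCircle → ℝ) (_ : IsAdmissiblePair T μ v), pairEnergy T μ v

/-- `ν` is the weak limit of `μ_t` along the filter `l`. With `l = 𝓝[<] T ⊓ ae volume` (limit as
`t ↑ T`, up to a null set of times) this says that `ν` is the trace `μ_T`. Null sets of times have
to be disregarded, because `μ_t` is determined by `dt ⊗ μ_t` only for almost every `t`. -/
def IsTraceAlong (l : Filter ℝ) (μ : Kernel ℝ UnitAddCircle) (ν : Measure UnitAddCircle) : Prop :=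
  IsFiniteMeasure ν ∧ ∀ f : C(UnitAddCircle, ℝ),
    Tendsto (fun t => ∫ x, f x ∂(μ t)) l (𝓝 (∫ x, f x ∂ν))

/-- `W_per²(ν, 1)` for the trace `ν` of `μ` along `l` (traces are unique). -/
def boundaryCost (l : Filter ℝ) (μ : Kernel ℝ UnitAddCircle) : ℝ≥0∞ :=
  ⨅ (ν : Measure UnitAddCircle) (_ : IsTraceAlong l μ ν), wassersteinPerSq ν volume

/-- `E^{1d}_{λ,T}(μ) = I(μ) + λ (W_per²(μ_T, 1) + W_per²(μ_{-T}, 1))`. -/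
def energy1d (lam T : ℝ) (μ : Kernel ℝ UnitAddCircle) : ℝ≥0∞ :=
  internalEnergy T μ + ENNReal.ofReal lam *
    (boundaryCost (𝓝[<] T ⊓ ae volume) μ + boundaryCost (𝓝[>] (-T) ⊓ ae volume) μ)

/-- The minimal value of `E^{1d}_{λ,T}` over the admissible measures. -/
def minEnergy1d (lam T : ℝ) : ℝ≥0∞ :=
  ⨅ (μ : Kernel ℝ UnitAddCircle) (_ : IsAdmissible T μ), energy1d lam T μ

end

/-! ## Lower bound for the Lagrangian energy -/

/-! Lagrangian lower bound: the multiplicity never exceeds `Φ`, so the branching term is at least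
`T`; Cauchy-Schwarz along each curve gives kinetic energy at least `x ^ 2 / T_λ`, which integrates
to `Φ ^ 3 / (12 T_λ)`.

Lagrangian upper bound: two competitors suffice. If `lam * T ≤ 1`, all mass waits at the origin
until `T` and then spreads at constant speed (`lateIrrigation`). If `lam * T ≥ 1`, the mass follows
a dyadic tree that has reached the identity at time `T` (`branchIrrigation`). In stage `k` of the
tree there are of order `2 ^ k` branches, displacements of order `2⁻ᵏ` and durations of order `3⁻ᵏ`.
The counting term is then a geometric series of ratio `2/3` and the kinetic term one of ratio `3/4`;
any time ratio strictly between `2` and `4` would make both converge.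

Upper bound on the circle: split the circle into `n` equal cells. Keeping one Dirac mass fixed at
each centre costs of order `n T + lam / n ^ 2`; running the dyadic tree in each cell, reflected in
time so that Lebesgue measure is attained at both ends, costs of order `n T + 1 / (n ^ 2 T)`.
Optimizing the integer `n` yields `T + lam ^ (1/3) T ^ (2/3)` and `T + T ^ (1/3)`.

Lower bound on the circle: argue directly by duality. For a.e. `t` the measure `μ_t` has `N` atoms;
test with the distance to these atoms. Its integral is `0` against `μ_t` but at least `1 / (8 N)`
against Lebesgue measure (`le_integral_infDist`). Passing from `μ_t` to the trace at `T` costs at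
most `∫ |v| ≤ √(2 T E)` by the continuity equation (`IsAdmissiblePair.ae_enorm_integral_sub_le`),
and passing from the trace to Lebesgue measure costs at most the Wasserstein distance, hence `√(E /
lam)` (`enorm_integral_sub_sq_le`). So `N ≥ 1 / (8 (√(2 T E) + √(E / lam)))`; integrating in time,
together with `N ≥ 1`, gives the scaling (`scaling_lower_bound`).

The test function depends on `t`, whereas the continuity equation holds off a null set of times
depending on the test function. A countable family therefore replaces the distances: smoothed
distances to finite subsets of a dense sequence. -/

theorem sq_lintegral_le {α : Type*} [MeasurableSpace α] {μ : Measure α} {f : α → ℝ≥0∞}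
    (hf : AEMeasurable f μ) : (∫⁻ a, f a ∂μ) ^ 2 ≤ μ univ * ∫⁻ a, f a ^ 2 ∂μ := by
  have h := ENNReal.lintegral_mul_le_Lp_mul_Lq μ Real.HolderConjugate.two_two
    (f := fun _ => 1) (g := f) aemeasurable_const hf
  simp only [Pi.mul_apply, one_mul, ENNReal.one_rpow, lintegral_const] at h
  calc (∫⁻ a, f a ∂μ) ^ 2
      ≤ (μ univ ^ (1 / 2 : ℝ) * (∫⁻ a, f a ^ (2 : ℝ) ∂μ) ^ (1 / 2 : ℝ)) ^ 2 := by gcongr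
    _ = μ univ * ∫⁻ a, f a ^ 2 ∂μ := by
      rw [mul_pow, ← ENNReal.rpow_natCast, ← ENNReal.rpow_mul, ← ENNReal.rpow_natCast,
        ← ENNReal.rpow_mul]
      norm_num

/-- The squared increment of an absolutely continuous curve is controlled by its action. -/
theorem AbsolutelyContinuousOnInterval.enorm_sub_sq_le {f : ℝ → ℝ} {a b : ℝ} (hab : a ≤ b)
    (hf : AbsolutelyContinuousOnInterval f a b) :
    ‖f b - f a‖ₑ ^ 2 ≤ ENNReal.ofReal (b - a) * ∫⁻ t in Ioo a b, ‖deriv f t‖ₑ ^ 2 := by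
  rw [← hf.integral_deriv_eq_sub, intervalIntegral.integral_of_le hab, integral_Ioc_eq_integral_Ioo]
  calc ‖∫ t in Ioo a b, deriv f t‖ₑ ^ 2
      ≤ (∫⁻ t in Ioo a b, ‖deriv f t‖ₑ) ^ 2 := by
        gcongr
        exact enorm_integral_le_lintegral_enorm _
    _ ≤ _ := by
      refine (sq_lintegral_le (measurable_deriv f).enorm.aemeasurable).trans_eq ?_
      simp

theorem lintegral_Icc_ofReal_sq_div {Φ τ : ℝ} (hΦ : 0 < Φ) (hτ : 0 < τ) :
    ∫⁻ x in Icc (-(Φ / 2)) (Φ / 2), ENNReal.ofReal (x ^ 2 / τ)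
      = ENNReal.ofReal (Φ ^ 3 / (12 * τ)) := by
  rw [← ofReal_integral_eq_lintegral_ofReal]
  · rw [integral_Icc_eq_integral_Ioc, ← intervalIntegral.integral_of_le (by linarith),
      intervalIntegral.integral_div, integral_pow]
    congr 1
    field_simp
    ring
  · exact (Continuous.continuousOn (by fun_prop)).integrableOn_Icc
  · exact Eventually.of_forall fun x => by positivity

theorem effTime_pos {T lam : ℝ} (hT : 0 < T) (hl : 0 < lam) : 0 < effTime T lam := by
  unfold effTime; positivity

/-- The two terms are bounded separately: every multiplicity is at most `Φ`, and a curve from `0` to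
`x` in time `T_λ` has action at least `x ^ 2 / T_λ`. -/
theorem ofReal_le_lagrangianEnergy {Φ T lam : ℝ} (hΦ : 0 < Φ) (hT : 0 < T) (hl : 0 < lam)
    {X : ℝ → ℝ → ℝ} (hX : IsIrrigation Φ (effTime T lam) 0 X) :
    ENNReal.ofReal (T + Φ ^ 3 / (12 * effTime T lam)) ≤ lagrangianEnergy Φ T lam X := by
  have hτ := effTime_pos hT hl
  rw [ENNReal.ofReal_add hT.le (by positivity)]
  refine add_le_add ?_ ?_
  · calc ENNReal.ofReal T = ∫⁻ t in Ioo 0 T, ∫⁻ x in Icc (-(Φ / 2)) (Φ / 2),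
          (ENNReal.ofReal Φ)⁻¹ := by
            simp only [lintegral_const, Measure.restrict_apply MeasurableSet.univ, univ_inter,
              Real.volume_Icc, Real.volume_Ioo]
            rw [show Φ / 2 - -(Φ / 2) = Φ by ring, sub_zero, ENNReal.inv_mul_cancel, one_mul]
            · simpa using hΦ
            · exact ENNReal.ofReal_ne_top
      _ ≤ _ := by
        refine lintegral_mono fun t => lintegral_mono fun x => ENNReal.inv_le_inv.2 ?_
        refine (measure_mono fun y hy => hy.1).trans_eq (b := volume (Icc (-(Φ / 2)) (Φ / 2))) ?_
        rw [Real.volume_Icc]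
        congr 1
        ring
  · rw [← lintegral_Icc_ofReal_sq_div hΦ hτ]
    refine lintegral_mono_ae ?_
    filter_upwards [hX.absCont, ae_restrict_mem measurableSet_Icc] with x hx hxm
    have h := hx.enorm_sub_sq_le hτ.le
    simp only [hX.start x hxm, hX.finish x hxm, sub_zero] at h
    rw [ENNReal.ofReal_div_of_pos hτ]
    refine ENNReal.div_le_of_le_mul' (le_trans (le_of_eq ?_) h)
    rw [← Real.enorm_of_nonneg (sq_nonneg x), enorm_pow]

noncomputable section

/-! ## Dyadic cells -/

/-- The centre of the cell `((j - 1) ℓ, j ℓ]`, `j ∈ ℤ`, that contains `y`. -/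
def cellCenter (ℓ y : ℝ) : ℝ := (⌈y / ℓ⌉ - 1 / 2) * ℓ

theorem mem_cell {ℓ : ℝ} (hℓ : 0 < ℓ) (y : ℝ) :
    y ∈ Ioc (cellCenter ℓ y - ℓ / 2) (cellCenter ℓ y + ℓ / 2) := by
  have h1 := Int.le_ceil (y / ℓ)
  have h2 := Int.ceil_lt_add_one (y / ℓ)
  rw [div_le_iff₀ hℓ] at h1
  rw [← sub_lt_iff_lt_add, lt_div_iff₀ hℓ] at h2
  constructor <;> unfold cellCenter <;> nlinarith

theorem cellCenter_eq_of_mem {ℓ : ℝ} (hℓ : 0 < ℓ) (j : ℤ) {y : ℝ}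
    (h : y ∈ Ioc ((j - 1) * ℓ) (j * ℓ)) : cellCenter ℓ y = (j - 1 / 2) * ℓ := by
  have : ⌈y / ℓ⌉ = j := by
    rw [Int.ceil_eq_iff, lt_div_iff₀ hℓ, div_le_iff₀ hℓ]
    exact h
  rw [cellCenter, this]

theorem cellCenter_eq_of_mem_cell {ℓ : ℝ} (hℓ : 0 < ℓ) {x y : ℝ}
    (h : y ∈ Ioc (cellCenter ℓ x - ℓ / 2) (cellCenter ℓ x + ℓ / 2)) :
    cellCenter ℓ y = cellCenter ℓ x := by
  refine cellCenter_eq_of_mem hℓ ⌈x / ℓ⌉ ?_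
  simp only [cellCenter, mem_Ioc] at h ⊢
  constructor <;> linarith [h.1, h.2]

theorem cellCenter_half {ℓ : ℝ} (hℓ : 0 < ℓ) (x : ℝ) :
    cellCenter (ℓ / 2) x = cellCenter ℓ x + ℓ / 4 ∨
      cellCenter (ℓ / 2) x = cellCenter ℓ x - ℓ / 4 := by
  have hx := mem_cell hℓ x
  rcases lt_or_ge (cellCenter ℓ x) x with h | h
  · left
    have := cellCenter_eq_of_mem (y := x) (half_pos hℓ) (2 * ⌈x / ℓ⌉) (by
      simp only [cellCenter, mem_Ioc] at hx h ⊢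
      push_cast
      constructor <;> linarith [hx.1, hx.2])
    rw [this, cellCenter]
    push_cast
    ring
  · right
    have := cellCenter_eq_of_mem (y := x) (half_pos hℓ) (2 * ⌈x / ℓ⌉ - 1) (by
      simp only [cellCenter, mem_Ioc] at hx h ⊢
      push_cast
      constructor <;> linarith [hx.1, hx.2])
    rw [this, cellCenter]
    push_cast
    ring

theorem measurable_cellCenter (ℓ : ℝ) : Measurable (cellCenter ℓ) := by
  unfold cellCenter
  have : Measurable fun y : ℝ => (⌈y / ℓ⌉ : ℝ) :=
    (measurable_from_top (f := fun n : ℤ => (n : ℝ))).comp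
      (Int.measurable_ceil.comp (measurable_id.div_const ℓ))
  fun_prop

/-- The centre of the dyadic cell of generation `k`, of length `L / 2 ^ k`. -/
def dyadicCenter (L : ℝ) (k : ℕ) (x : ℝ) : ℝ := cellCenter (L / 2 ^ k) x

theorem dyadicCenter_succ {L : ℝ} (hL : 0 < L) (k : ℕ) (x : ℝ) :
    dyadicCenter L (k + 1) x = dyadicCenter L k x + L / 2 ^ k / 4 ∨
      dyadicCenter L (k + 1) x = dyadicCenter L k x - L / 2 ^ k / 4 := by
  have := cellCenter_half (ℓ := L / 2 ^ k) (by positivity) x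
  rwa [div_div, ← pow_succ] at this

theorem abs_dyadicCenter_succ_sub {L : ℝ} (hL : 0 < L) (k : ℕ) (x : ℝ) :
    |dyadicCenter L (k + 1) x - dyadicCenter L k x| = L / 2 ^ k / 4 := by
  have : 0 < L / 2 ^ k / 4 := by positivity
  rcases dyadicCenter_succ hL k x with h | h <;> rw [h]
  · rw [add_sub_cancel_left, abs_of_pos this]
  · rw [sub_sub_cancel_left, abs_neg, abs_of_pos this]

theorem mem_dyadicCell {L : ℝ} (hL : 0 < L) (k : ℕ) (x : ℝ) :
    x ∈ Ioc (dyadicCenter L k x - L / 2 ^ k / 2) (dyadicCenter L k x + L / 2 ^ k / 2) :=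
  mem_cell (by positivity) x

theorem abs_sub_dyadicCenter_le {L : ℝ} (hL : 0 < L) (k : ℕ) (x : ℝ) :
    |x - dyadicCenter L k x| ≤ L / 2 ^ k / 2 := by
  have := mem_dyadicCell hL k x
  rw [abs_le]
  constructor <;> linarith [this.1, this.2]

theorem dyadicCenter_eq_of_mem {L : ℝ} (hL : 0 < L) {k : ℕ} {x y : ℝ}
    (h : y ∈ Ioc (dyadicCenter L k x - L / 2 ^ k / 2) (dyadicCenter L k x + L / 2 ^ k / 2)) :
    dyadicCenter L k y = dyadicCenter L k x :=
  cellCenter_eq_of_mem_cell (by positivity) h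

theorem dyadicCenter_dyadicCenter_succ {L : ℝ} (hL : 0 < L) (k : ℕ) (x : ℝ) :
    dyadicCenter L k (dyadicCenter L (k + 1) x) = dyadicCenter L k x := by
  have : 0 < L / 2 ^ k := by positivity
  apply dyadicCenter_eq_of_mem hL
  rcases dyadicCenter_succ hL k x with h | h <;> rw [h] <;> constructor <;> linarith

/-- Dyadic cells are nested, so a cell of a later generation determines all its ancestors. -/
theorem dyadicCenter_eq_of_le {L : ℝ} (hL : 0 < L) {j k : ℕ} (hjk : j ≤ k) {x y : ℝ}
    (h : dyadicCenter L k x = dyadicCenter L k y) : dyadicCenter L j x = dyadicCenter L j y := by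
  induction k, hjk using Nat.le_induction with
  | base => exact h
  | succ k _ ih =>
    apply ih
    rw [← dyadicCenter_dyadicCenter_succ hL, h, dyadicCenter_dyadicCenter_succ hL]

theorem tendsto_dyadicCenter {L : ℝ} (hL : 0 < L) (x : ℝ) :
    Tendsto (fun k => dyadicCenter L k x) atTop (𝓝 x) := by
  rw [tendsto_iff_dist_tendsto_zero]
  refine squeeze_zero (g := fun k : ℕ => L / 2 * (1 / 2) ^ k) (fun _ => dist_nonneg) (fun k => ?_) ?_
  · rw [dist_comm, Real.dist_eq]
    refine (abs_sub_dyadicCenter_le hL k x).trans_eq ?_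
    rw [one_div, inv_pow]
    ring
  · simpa using (tendsto_pow_atTop_nhds_zero_of_lt_one (r := (1 / 2 : ℝ)) (by norm_num)
      (by norm_num)).const_mul (L / 2)

theorem measurable_dyadicCenter (L : ℝ) (k : ℕ) : Measurable (dyadicCenter L k) :=
  measurable_cellCenter _

/-! ## The branching times -/

/-- The time `T (1 - 3⁻ᵏ)` at which the `k`-th stage of the branching begins. -/
def branchTime (T : ℝ) (k : ℕ) : ℝ := T * (1 - (1 / 3) ^ k)

/-- The duration of the `k`-th stage. -/
def branchDuration (T : ℝ) (k : ℕ) : ℝ := T * (2 / 3 * (1 / 3) ^ k)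

theorem branchDuration_pos {T : ℝ} (hT : 0 < T) (k : ℕ) : 0 < branchDuration T k := by
  unfold branchDuration; positivity

theorem branchTime_succ (T : ℝ) (k : ℕ) :
    branchTime T (k + 1) = branchTime T k + branchDuration T k := by
  unfold branchTime branchDuration; ring

@[simp] theorem branchTime_zero (T : ℝ) : branchTime T 0 = 0 := by simp [branchTime]

theorem strictMono_branchTime {T : ℝ} (hT : 0 < T) : StrictMono (branchTime T) :=
  strictMono_nat_of_lt_succ fun k => by
    rw [branchTime_succ]; linarith [branchDuration_pos hT k]

theorem branchTime_nonneg {T : ℝ} (hT : 0 < T) (k : ℕ) : 0 ≤ branchTime T k := by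
  simpa using (strictMono_branchTime hT).monotone (Nat.zero_le k)

theorem branchTime_lt {T : ℝ} (hT : 0 < T) (k : ℕ) : branchTime T k < T := by
  have : (0 : ℝ) < (1 / 3) ^ k := by positivity
  unfold branchTime; nlinarith

theorem exists_mem_stage {T t : ℝ} (ht : t ∈ Ico 0 T) :
    ∃ k, t ∈ Ico (branchTime T k) (branchTime T (k + 1)) := by
  have hT : 0 < T := ht.1.trans_lt ht.2
  have hex : ∃ k, t < branchTime T k := by
    have : Tendsto (fun k => branchTime T k) atTop (𝓝 T) := by
      simpa [branchTime] using ((tendsto_pow_atTop_nhds_zero_of_lt_one (r := (1 / 3 : ℝ))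
        (by norm_num) (by norm_num)).const_sub 1).const_mul T
    exact (this.eventually (lt_mem_nhds ht.2)).exists
  classical
  -- The stage sought is the one just before the first branching time exceeding `t`.
  have h0 : Nat.find hex ≠ 0 := fun h => by
    have := Nat.find_spec hex
    rw [h, branchTime_zero] at this
    exact absurd ht.1 (not_le.2 this)
  obtain ⟨k, hk⟩ := Nat.exists_eq_succ_of_ne_zero h0
  refine ⟨k, not_lt.1 (Nat.find_min hex (by omega)), ?_⟩
  have := Nat.find_spec hex
  rwa [hk] at this

/-- A function that is bounded by `a k` during the `k`-th stage has integral at most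
`∑ a k * branchDuration T k`. -/
theorem lintegral_le_of_stage {T : ℝ} (hT : 0 < T) {f : ℝ → ℝ≥0∞} {a : ℕ → ℝ} {S : ℝ}
    (ha : ∀ k, 0 ≤ a k) (hS : HasSum (fun k => a k * branchDuration T k) S)
    (hf : ∀ k, ∀ t ∈ Ioo (branchTime T k) (branchTime T (k + 1)), f t ≤ ENNReal.ofReal (a k)) :
    ∫⁻ t in Ioo 0 T, f t ≤ ENNReal.ofReal S := by
  calc ∫⁻ t in Ioo 0 T, f t
      ≤ ∫⁻ t in ⋃ k, Ico (branchTime T k) (branchTime T (k + 1)), f t := by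
        refine lintegral_mono_set fun t ht => mem_iUnion.2 ?_
        exact exists_mem_stage ⟨ht.1.le, ht.2⟩
    _ ≤ ∑' k, ∫⁻ t in Ico (branchTime T k) (branchTime T (k + 1)), f t := lintegral_iUnion_le _ _
    _ ≤ ∑' k, ENNReal.ofReal (a k * branchDuration T k) := by
        refine ENNReal.tsum_le_tsum fun k => ?_
        rw [← Measure.restrict_congr_set (Ioo_ae_eq_Ico (a := branchTime T k))]
        refine (setLIntegral_mono measurable_const (hf k)).trans_eq ?_
        rw [setLIntegral_const, Real.volume_Ioo, branchTime_succ, add_sub_cancel_left,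
          ENNReal.ofReal_mul (ha k)]
    _ = ENNReal.ofReal S := by
        rw [← hS.tsum_eq, ENNReal.ofReal_tsum_of_nonneg _ hS.summable]
        exact fun k => mul_nonneg (ha k) (branchDuration_pos hT k).le

/-- The piecewise affine function that increases from `0` to `1` during the `k`-th stage. -/
def ramp (T : ℝ) (k : ℕ) (t : ℝ) : ℝ := max 0 (min 1 ((t - branchTime T k) / branchDuration T k))

theorem ramp_nonneg (T : ℝ) (k : ℕ) (t : ℝ) : 0 ≤ ramp T k t := le_max_left _ _

theorem ramp_le_one (T : ℝ) (k : ℕ) (t : ℝ) : ramp T k t ≤ 1 :=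
  max_le zero_le_one (min_le_left _ _)

theorem continuous_ramp (T : ℝ) (k : ℕ) : Continuous (ramp T k) := by
  unfold ramp; fun_prop

theorem ramp_eq_zero {T : ℝ} (hT : 0 < T) {k : ℕ} {t : ℝ} (h : t ≤ branchTime T k) :
    ramp T k t = 0 := by
  have := div_nonpos_of_nonpos_of_nonneg (sub_nonpos.2 h) (branchDuration_pos hT k).le
  exact max_eq_left ((min_le_right _ _).trans this)

theorem ramp_eq_one {T : ℝ} (hT : 0 < T) {k : ℕ} {t : ℝ} (h : branchTime T (k + 1) ≤ t) :
    ramp T k t = 1 := by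
  have : 1 ≤ (t - branchTime T k) / branchDuration T k := by
    rw [one_le_div (branchDuration_pos hT k)]
    linarith [branchTime_succ T k]
  rw [ramp, min_eq_left this, max_eq_right zero_le_one]

theorem ramp_of_mem {T : ℝ} (hT : 0 < T) {k : ℕ} {t : ℝ}
    (h : t ∈ Icc (branchTime T k) (branchTime T (k + 1))) :
    ramp T k t = (t - branchTime T k) / branchDuration T k := by
  have hd := branchDuration_pos hT k
  have h1 : (t - branchTime T k) / branchDuration T k ≤ 1 := by
    rw [div_le_one hd]
    linarith [branchTime_succ T k, h.2]
  rw [ramp, min_eq_right h1, max_eq_right (div_nonneg (sub_nonneg.2 h.1) hd.le)]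

/-! ## The branching flow -/

/-- The flow that starts at the centres of the cells of length `L` and moves, during the `k`-th
stage, from the centres of the cells of generation `k` to those of generation `k + 1`. It reaches
the identity at time `T`. -/
def branchFlow (L T t x : ℝ) : ℝ :=
  dyadicCenter L 0 x + ∑' k, (dyadicCenter L (k + 1) x - dyadicCenter L k x) * ramp T k t

theorem norm_branchFlow_term_le {L : ℝ} (hL : 0 < L) (T t x : ℝ) (k : ℕ) :
    ‖(dyadicCenter L (k + 1) x - dyadicCenter L k x) * ramp T k t‖ ≤ L / 4 * (1 / 2) ^ k := by
  rw [norm_mul, Real.norm_eq_abs, abs_dyadicCenter_succ_sub hL, Real.norm_of_nonneg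
    (ramp_nonneg _ _ _)]
  calc L / 2 ^ k / 4 * ramp T k t ≤ L / 2 ^ k / 4 * 1 := by
        gcongr
        exact ramp_le_one _ _ _
    _ = L / 4 * (1 / 2) ^ k := by rw [one_div, inv_pow]; ring

theorem summable_branchFlow_bound (L : ℝ) : Summable fun k : ℕ => L / 4 * (1 / 2 : ℝ) ^ k :=
  (summable_geometric_of_lt_one (by norm_num) (by norm_num)).mul_left _

theorem summable_branchFlow {L : ℝ} (hL : 0 < L) (T t x : ℝ) :
    Summable fun k => (dyadicCenter L (k + 1) x - dyadicCenter L k x) * ramp T k t :=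
  .of_norm_bounded (summable_branchFlow_bound L) (norm_branchFlow_term_le hL T t x)

theorem continuous_branchFlow {L : ℝ} (hL : 0 < L) (T x : ℝ) :
    Continuous fun t => branchFlow L T t x :=
  continuous_const.add <| continuous_tsum
    (fun k => continuous_const.mul (continuous_ramp T k)) (summable_branchFlow_bound L)
    fun k t => norm_branchFlow_term_le hL T t x k

theorem measurable_tsum_real {α : Type*} [MeasurableSpace α] {f : ℕ → α → ℝ}
    (hf : ∀ k, Measurable (f k)) (hs : ∀ a, Summable fun k => f k a) :
    Measurable fun a => ∑' k, f k a :=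
  measurable_of_tendsto_metrizable (f := fun n a => ∑ k ∈ Finset.range n, f k a)
    (fun _ => Finset.measurable_fun_sum _ fun k _ => hf k)
    (tendsto_pi_nhds.2 fun a => (hs a).hasSum.tendsto_sum_nat)

theorem measurable_branchFlow {L : ℝ} (hL : 0 < L) (T : ℝ) :
    Measurable fun p : ℝ × ℝ => branchFlow L T p.1 p.2 := by
  have hd : ∀ k, Measurable fun p : ℝ × ℝ => dyadicCenter L k p.2 :=
    fun k => (measurable_dyadicCenter L k).comp measurable_snd
  have hr : ∀ k, Measurable fun p : ℝ × ℝ => ramp T k p.1 :=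
    fun k => (continuous_ramp T k).measurable.comp measurable_fst
  exact (hd 0).add (measurable_tsum_real (fun k => ((hd (k + 1)).sub (hd k)).mul (hr k))
    fun p => summable_branchFlow hL T p.1 p.2)

theorem branchFlow_of_nonpos {L T t : ℝ} (hT : 0 < T) (ht : t ≤ 0) (x : ℝ) :
    branchFlow L T t x = dyadicCenter L 0 x := by
  have : ∀ k, ramp T k t = 0 := fun k => ramp_eq_zero hT (ht.trans (branchTime_nonneg hT k))
  simp [branchFlow, this]

theorem branchFlow_of_le {L T t : ℝ} (hL : 0 < L) (hT : 0 < T) (ht : T ≤ t) (x : ℝ) :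
    branchFlow L T t x = x := by
  have hr : ∀ k, ramp T k t = 1 := fun k => ramp_eq_one hT ((branchTime_lt hT _).le.trans ht)
  have hs := (summable_branchFlow hL T t x).hasSum.tendsto_sum_nat
  simp only [hr, mul_one, Finset.sum_range_sub fun k => dyadicCenter L k x] at hs
  have := tendsto_nhds_unique hs ((tendsto_dyadicCenter hL x).sub_const _)
  simp only [branchFlow, hr, mul_one, this]
  ring

/-- The ramps of earlier stages are complete, so their increments telescope to the centre of
generation `k`; the ramps of later stages have not started. -/
theorem branchFlow_of_mem {L T t : ℝ} (hT : 0 < T) {k : ℕ}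
    (ht : t ∈ Icc (branchTime T k) (branchTime T (k + 1))) (x : ℝ) :
    branchFlow L T t x = dyadicCenter L k x +
      (dyadicCenter L (k + 1) x - dyadicCenter L k x) *
        ((t - branchTime T k) / branchDuration T k) := by
  have hmono := (strictMono_branchTime hT).monotone
  rw [branchFlow, tsum_eq_sum (s := Finset.range (k + 1)), Finset.sum_range_succ, ramp_of_mem hT ht,
    Finset.sum_congr (g := fun j => dyadicCenter L (j + 1) x - dyadicCenter L j x) rfl,
    Finset.sum_range_sub fun k => dyadicCenter L k x]
  · ring
  · intro j hj
    rw [ramp_eq_one hT ((hmono (by simpa using hj)).trans ht.1), mul_one]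
  · intro j hj
    rw [ramp_eq_zero hT (ht.2.trans (hmono (by simpa using hj))), mul_zero]

/-- During the `k`-th stage the flow stays in the cell of generation `k + 1` that it enters. -/
theorem dyadicCenter_succ_branchFlow {L T t : ℝ} (hL : 0 < L) (hT : 0 < T) {k : ℕ}
    (ht : t ∈ Ioo (branchTime T k) (branchTime T (k + 1))) (x : ℝ) :
    dyadicCenter L (k + 1) (branchFlow L T t x) = dyadicCenter L (k + 1) x := by
  have hd := branchDuration_pos hT k
  have hℓ : 0 < L / 2 ^ k := by positivity
  have hhalf : L / 2 ^ (k + 1) = L / 2 ^ k / 2 := by rw [pow_succ, div_div]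
  -- Strict positivity is needed: at the start of the stage both halves of a cell sit at its
  -- midpoint, which belongs to the left half only.
  have h0 : 0 < (t - branchTime T k) / branchDuration T k := div_pos (sub_pos.2 ht.1) hd
  have h1 : (t - branchTime T k) / branchDuration T k < 1 := by
    rw [div_lt_one hd]
    linarith [branchTime_succ T k, ht.2]
  apply dyadicCenter_eq_of_mem hL
  rw [branchFlow_of_mem hT ⟨ht.1.le, ht.2.le⟩, hhalf]
  rcases dyadicCenter_succ hL k x with h | h <;> rw [h] <;> constructor <;> nlinarith

/-- The velocity during the `k`-th stage. -/
def branchSlope (L T : ℝ) (k : ℕ) (x : ℝ) : ℝ :=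
  (dyadicCenter L (k + 1) x - dyadicCenter L k x) / branchDuration T k

/-- The velocity field of the branching flow. -/
def branchVelocity (L T t x : ℝ) : ℝ :=
  ∑' k, (Ioo (branchTime T k) (branchTime T (k + 1))).indicator (fun _ => branchSlope L T k x) t

theorem indicator_stage_eq_zero {T t : ℝ} (hT : 0 < T) {k : ℕ}
    (ht : t ∈ Ioo (branchTime T k) (branchTime T (k + 1))) (f : ℕ → ℝ) (j : ℕ) (hj : j ≠ k) :
    (Ioo (branchTime T j) (branchTime T (j + 1))).indicator (fun _ => f j) t = 0 := by
  have hmono := (strictMono_branchTime hT).monotone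
  refine indicator_of_notMem (fun h => ?_) _
  rcases lt_or_gt_of_ne hj with hlt | hgt
  · exact absurd (h.2.trans_le (hmono hlt)) (not_lt.2 ht.1.le)
  · exact absurd (ht.2.trans_le (hmono hgt)) (not_lt.2 h.1.le)

theorem branchVelocity_of_mem {L T t : ℝ} (hT : 0 < T) {k : ℕ}
    (ht : t ∈ Ioo (branchTime T k) (branchTime T (k + 1))) (x : ℝ) :
    branchVelocity L T t x = branchSlope L T k x := by
  rw [branchVelocity, tsum_eq_single k (indicator_stage_eq_zero hT ht fun j => branchSlope L T j x),
    indicator_of_mem ht]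

theorem measurable_branchVelocity {T : ℝ} (hT : 0 < T) (L : ℝ) :
    Measurable fun p : ℝ × ℝ => branchVelocity L T p.1 p.2 := by
  refine measurable_tsum_real (fun k => ?_) fun p => ?_
  · have : Measurable fun p : ℝ × ℝ => branchSlope L T k p.2 :=
      (((measurable_dyadicCenter L (k + 1)).comp measurable_snd).sub
        ((measurable_dyadicCenter L k).comp measurable_snd)).div_const _
    exact this.indicator (measurableSet_Ioo.preimage measurable_fst)
  · by_cases h : ∃ k, p.1 ∈ Ioo (branchTime T k) (branchTime T (k + 1))
    · obtain ⟨k, hk⟩ := h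
      exact summable_of_ne_finset_zero (s := {k}) fun j hj =>
        indicator_stage_eq_zero hT hk (fun j => branchSlope L T j p.2) j (by simpa using hj)
    · push Not at h
      simpa only [indicator_of_notMem (h _)] using summable_zero

/-- The current position already lies in the cell of generation `k + 1` being entered, and that cell
determines the velocity. The velocity is thus a function of position, which makes it an Eulerian
field. -/
theorem branchVelocity_branchFlow {L T t : ℝ} (hL : 0 < L) (hT : 0 < T) {k : ℕ}
    (ht : t ∈ Ioo (branchTime T k) (branchTime T (k + 1))) (x : ℝ) :
    branchVelocity L T t (branchFlow L T t x) = branchVelocity L T t x := by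
  have h := dyadicCenter_succ_branchFlow hL hT ht x
  rw [branchVelocity_of_mem hT ht, branchVelocity_of_mem hT ht, branchSlope, branchSlope, h,
    dyadicCenter_eq_of_le hL k.le_succ h]

theorem hasDerivAt_branchFlow {L T t : ℝ} (hT : 0 < T) {k : ℕ}
    (ht : t ∈ Ioo (branchTime T k) (branchTime T (k + 1))) (x : ℝ) :
    HasDerivAt (fun s => branchFlow L T s x) (branchVelocity L T t x) t := by
  rw [branchVelocity_of_mem hT ht]
  have h : HasDerivAt (fun s => dyadicCenter L k x + (dyadicCenter L (k + 1) x - dyadicCenter L k x) *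
        ((s - branchTime T k) / branchDuration T k)) (branchSlope L T k x) t := by
    have := ((((hasDerivAt_id t).sub_const (branchTime T k)).div_const
      (branchDuration T k)).const_mul
        (dyadicCenter L (k + 1) x - dyadicCenter L k x)).const_add (dyadicCenter L k x)
    convert! this using 1
    rw [branchSlope]
    ring
  refine h.congr_of_eventuallyEq ?_
  filter_upwards [Ioo_mem_nhds ht.1 ht.2] with s hs
  exact branchFlow_of_mem hT ⟨hs.1.le, hs.2.le⟩ x

/-- Stage `k` contributes displacement squared over duration, that is `3 L ^ 2 / (32 T) * (3/4) ^
k`; the geometric series sums to `4`. -/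
theorem lintegral_branchVelocity_sq_le {L T : ℝ} (hL : 0 < L) (hT : 0 < T) (x : ℝ) :
    ∫⁻ t in Ioo 0 T, ‖branchVelocity L T t x‖ₑ ^ 2 ≤ ENNReal.ofReal (3 * L ^ 2 / (8 * T)) := by
  refine lintegral_le_of_stage hT (a := fun k => (L / 2 ^ k / 4 / branchDuration T k) ^ 2)
    (fun k => sq_nonneg _) ?_ fun k t ht => ?_
  · have h := (hasSum_geometric_of_lt_one (r := (3 / 4 : ℝ)) (by norm_num) (by norm_num)).mul_left
      (3 * L ^ 2 / (32 * T))
    convert! h using 1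
    · ext k
      have h4 : (4 : ℝ) ^ k = 2 ^ k * 2 ^ k := by rw [← mul_pow]; norm_num
      rw [branchDuration, one_div, inv_pow, div_pow (3 : ℝ) 4 k, h4]
      field_simp
      ring
    · field_simp
      norm_num
  · rw [branchVelocity_of_mem hT ht, branchSlope, ← enorm_pow, ← ofReal_norm, norm_pow, norm_div,
      Real.norm_eq_abs, abs_dyadicCenter_succ_sub hL, Real.norm_of_nonneg (branchDuration_pos hT k).le]

/-- Stage `k` contributes `4/3 * c * T * (2/3) ^ k`, and the geometric series sums to `3`. -/
theorem lintegral_branch_count_le {T c : ℝ} (hT : 0 < T) (hc : 0 ≤ c) {f : ℝ → ℝ≥0∞}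
    (hf : ∀ k, ∀ t ∈ Ioo (branchTime T k) (branchTime T (k + 1)),
      f t ≤ ENNReal.ofReal (c * 2 ^ (k + 1))) :
    ∫⁻ t in Ioo 0 T, f t ≤ ENNReal.ofReal (4 * c * T) := by
  refine lintegral_le_of_stage hT (fun k => by positivity) ?_ hf
  have h := (hasSum_geometric_of_lt_one (r := (2 / 3 : ℝ)) (by norm_num) (by norm_num)).mul_left
    (4 / 3 * c * T)
  convert! h using 1
  · ext k
    rw [branchDuration, one_div, inv_pow, div_pow (2 : ℝ) 3 k]
    field_simp
    ring
  · norm_num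
    ring

theorem Measurable.branchFlow {α : Type*} [MeasurableSpace α] {L T : ℝ} (hL : 0 < L)
    {f g : α → ℝ} (hf : Measurable f) (hg : Measurable g) :
    Measurable fun a => branchFlow L T (f a) (g a) := by
  have h := (measurable_branchFlow hL T).comp (hf.prodMk hg)
  simpa only [Function.comp_def] using h

theorem Measurable.branchVelocity {α : Type*} [MeasurableSpace α] {L T : ℝ} (hT : 0 < T)
    {f g : α → ℝ} (hf : Measurable f) (hg : Measurable g) :
    Measurable fun a => branchVelocity L T (f a) (g a) := by
  have h := (measurable_branchVelocity hT L).comp (hf.prodMk hg)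
  simpa only [Function.comp_def] using h

/-! ## Upper bound for the Lagrangian energy -/

theorem branchVelocity_eq_zero {L T t : ℝ} (hT : 0 < T) (ht : t ∉ Ioo 0 T) (x : ℝ) :
    branchVelocity L T t x = 0 := by
  have : ∀ k, t ∉ Ioo (branchTime T k) (branchTime T (k + 1)) := fun k hk =>
    ht ⟨(branchTime_nonneg hT k).trans_lt hk.1, hk.2.trans (branchTime_lt hT _)⟩
  simp only [branchVelocity, indicator_of_notMem (this _), tsum_zero]

/-- The times at which the branching flow may fail to be differentiable. -/
def branchExceptional (T : ℝ) : Set ℝ := insert T (range (branchTime T))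

theorem countable_branchExceptional (T : ℝ) : (branchExceptional T).Countable :=
  (countable_range _).insert T

theorem exists_mem_Ioo_stage {T t : ℝ} (ht : t ∈ Ioo 0 T) (he : t ∉ branchExceptional T) :
    ∃ k, t ∈ Ioo (branchTime T k) (branchTime T (k + 1)) := by
  obtain ⟨k, hk⟩ := exists_mem_stage ⟨ht.1.le, ht.2⟩
  refine ⟨k, lt_of_le_of_ne hk.1 fun h => he (Or.inr ⟨k, h⟩), hk.2⟩

theorem hasDerivAt_branchFlow_of_notMem {L T t : ℝ} (hL : 0 < L) (hT : 0 < T)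
    (he : t ∉ branchExceptional T) (x : ℝ) :
    HasDerivAt (fun s => branchFlow L T s x) (branchVelocity L T t x) t := by
  rcases lt_trichotomy t 0 with h | h | h
  · rw [branchVelocity_eq_zero hT fun h' => lt_asymm h h'.1]
    refine (hasDerivAt_const t (dyadicCenter L 0 x)).congr_of_eventuallyEq ?_
    filter_upwards [Iio_mem_nhds h] with s hs
    exact branchFlow_of_nonpos hT hs.le x
  · exact absurd (Or.inr ⟨0, by rw [branchTime_zero, h]⟩) he
  · rcases lt_trichotomy t T with h' | h' | h'
    · obtain ⟨k, hk⟩ := exists_mem_Ioo_stage ⟨h, h'⟩ he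
      exact hasDerivAt_branchFlow hT hk x
    · exact absurd (Or.inl h') he
    · rw [branchVelocity_eq_zero hT fun h'' => lt_asymm h' h''.2]
      refine (hasDerivAt_const t x).congr_of_eventuallyEq ?_
      filter_upwards [Ioi_mem_nhds h'] with s hs
      exact branchFlow_of_le hL hT hs.le x

theorem lintegral_branchVelocity_sq_eq {T : ℝ} (hT : 0 < T) (L x : ℝ) :
    ∫⁻ t, ‖branchVelocity L T t x‖ₑ ^ 2 = ∫⁻ t in Ioo 0 T, ‖branchVelocity L T t x‖ₑ ^ 2 := by
  rw [← lintegral_indicator measurableSet_Ioo]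
  congr 1
  ext t
  by_cases h : t ∈ Ioo 0 T
  · rw [indicator_of_mem h]
  · rw [indicator_of_notMem h, branchVelocity_eq_zero hT h]
    simp

theorem memLp_two_of_lintegral_le {α : Type*} [MeasurableSpace α] {μ : Measure α} {f : α → ℝ}
    (hf : AEStronglyMeasurable f μ) {c : ℝ} (h : ∫⁻ a, ‖f a‖ₑ ^ 2 ∂μ ≤ ENNReal.ofReal c) :
    MemLp f 2 μ := by
  refine ⟨hf, ?_⟩
  rw [eLpNorm_lt_top_iff_lintegral_rpow_enorm_lt_top (by norm_num) (by norm_num)]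
  simpa using h.trans_lt ENNReal.ofReal_lt_top

theorem integrable_branchVelocity {L T : ℝ} (hL : 0 < L) (hT : 0 < T) (x : ℝ) :
    Integrable fun t => branchVelocity L T t x := by
  have hm : Measurable fun t => branchVelocity L T t x :=
    Measurable.branchVelocity hT measurable_id measurable_const
  refine (integrableOn_iff_integrable_of_support_subset (s := Ioo 0 T) fun t ht => ?_).1 ?_
  · by_contra h
    exact ht (branchVelocity_eq_zero hT h x)
  · have h2 : MemLp (fun t => branchVelocity L T t x) 2 (volume.restrict (Ioo 0 T)) :=
      memLp_two_of_lintegral_le hm.aestronglyMeasurable (lintegral_branchVelocity_sq_le hL hT x)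
    exact h2.integrable one_le_two

/-- A continuous function with an integrable derivative off a countable set is a primitive of that
derivative; integrability follows from the finite action. -/
theorem absolutelyContinuousOnInterval_branchFlow {L T : ℝ} (hL : 0 < L) (hT : 0 < T) (a b x : ℝ) :
    AbsolutelyContinuousOnInterval (fun t => branchFlow L T t x) a b := by
  have hi := fun c d => (integrable_branchVelocity hL hT x).intervalIntegrable (a := c) (b := d)
  have h : (fun t => branchFlow L T t x)
      = fun t => (∫ s in a..t, branchVelocity L T s x) + branchFlow L T a x := by
    ext t
    rw [integral_eq_of_hasDerivAt_off_countable (fun t => branchFlow L T t x) _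
      (countable_branchExceptional T) (continuous_branchFlow hL T x).continuousOn
      (fun s hs => hasDerivAt_branchFlow_of_notMem hL hT hs.2 x) (hi a t), sub_add_cancel]
  rw [h]
  exact ((hi a b).absolutelyContinuousOnInterval_intervalIntegral left_mem_uIcc).fun_add
    (LipschitzWith.const _).lipschitzOnWith.absolutelyContinuousOnInterval

/-- The irrigation of `[-Φ/2, Φ/2]` that follows the branching flow on `[0, T]`. The value at
time `0` is prescribed separately because of the left end point. -/
def branchIrrigation (Φ T t x : ℝ) : ℝ := if t = 0 then 0 else branchFlow Φ T t (x + Φ / 2) - Φ / 2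

theorem dyadicCenter_zero_of_mem {Φ x : ℝ} (hΦ : 0 < Φ) (hx : x ∈ Ioc 0 Φ) :
    dyadicCenter Φ 0 x = Φ / 2 := by
  have := cellCenter_eq_of_mem (y := x) hΦ 1 (by simpa using hx)
  rw [dyadicCenter, pow_zero, div_one, this]
  push_cast
  ring

theorem branchIrrigation_eq {Φ T x : ℝ} (hΦ : 0 < Φ) (hT : 0 < T)
    (hx : x ∈ Ioc (-(Φ / 2)) (Φ / 2)) (t : ℝ) :
    branchIrrigation Φ T t x = branchFlow Φ T t (x + Φ / 2) - Φ / 2 := by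
  rw [branchIrrigation]
  split_ifs with h
  · rw [branchFlow_of_nonpos hT h.le, dyadicCenter_zero_of_mem hΦ, sub_self]
    constructor <;> linarith [hx.1, hx.2]
  · rfl

theorem isIrrigation_branchIrrigation {Φ T τ : ℝ} (hΦ : 0 < Φ) (hT : 0 < T) (hτ : T ≤ τ) :
    IsIrrigation Φ τ 0 (branchIrrigation Φ T) where
  aemeasurable := by
    have h : Measurable fun p : ℝ × ℝ => branchFlow Φ T p.1 (p.2 + Φ / 2) :=
      Measurable.branchFlow hΦ measurable_fst (measurable_snd.add_const (Φ / 2))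
    have h0 : MeasurableSet {p : ℝ × ℝ | p.1 = 0} :=
      measurable_fst (measurableSet_singleton (0 : ℝ))
    exact (Measurable.ite h0 measurable_const (h.sub_const (Φ / 2))).aemeasurable
  start x _ := if_pos rfl
  finish x _ := by
    rw [branchIrrigation, if_neg (hT.trans_le hτ).ne', branchFlow_of_le hΦ hT hτ]
    ring
  absCont := by
    -- The left end point belongs to the neighbouring half-open cell, so its curve jumps at time
    -- `0`; it is a single label and is discarded.
    rw [Measure.restrict_congr_set Ioc_ae_eq_Icc.symm]
    filter_upwards [ae_restrict_mem measurableSet_Ioc] with x hx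
    simp only [branchIrrigation_eq hΦ hT hx]
    exact (absolutelyContinuousOnInterval_branchFlow hΦ hT 0 τ (x + Φ / 2)).fun_sub
      (LipschitzWith.const _).lipschitzOnWith.absolutelyContinuousOnInterval

/-- During stage `k` all labels of one cell of generation `k + 1` travel together, so the
multiplicity is at least `Φ / 2 ^ (k + 1)` and the inner integral is at most `2 ^ (k + 1)`. -/
theorem lagrangianEnergy_branchIrrigation_le {Φ T lam : ℝ} (hΦ : 0 < Φ) (hT : 0 < T) :
    lagrangianEnergy Φ T lam (branchIrrigation Φ T)
      ≤ ENNReal.ofReal (4 * T + Φ * (3 * Φ ^ 2 / (8 * T))) := by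
  rw [ENNReal.ofReal_add (by positivity) (by positivity)]
  refine add_le_add ?_ ?_
  · rw [← mul_one (4 : ℝ)]
    refine lintegral_branch_count_le hT zero_le_one fun k t ht => ?_
    have hsub : ∀ x ∈ Ioc (-(Φ / 2)) (Φ / 2),
        (curveMultiplicity Φ (branchIrrigation Φ T) (branchIrrigation Φ T t x) t)⁻¹
          ≤ (ENNReal.ofReal (Φ / 2 ^ (k + 1)))⁻¹ := by
      intro x hx
      refine ENNReal.inv_le_inv.2 ?_
      set c := dyadicCenter Φ (k + 1) (x + Φ / 2) with hc
      set ℓ := Φ / 2 ^ (k + 1) with hℓ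
      calc ENNReal.ofReal ℓ
          = volume (Ioc (c - ℓ / 2 - Φ / 2) (c + ℓ / 2 - Φ / 2)) := by
            rw [Real.volume_Ioc]
            congr 1
            ring
        _ ≤ _ := measure_mono fun y hy => ?_
      have hyx : dyadicCenter Φ (k + 1) (y + Φ / 2) = dyadicCenter Φ (k + 1) (x + Φ / 2) := by
        apply dyadicCenter_eq_of_mem hΦ
        constructor <;> linarith [hy.1, hy.2]
      have hy0 : y ∈ Ioc (-(Φ / 2)) (Φ / 2) := by
        have h0 := dyadicCenter_eq_of_le hΦ (Nat.zero_le (k + 1)) hyx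
        rw [dyadicCenter_zero_of_mem (x := x + Φ / 2) hΦ
          (by constructor <;> linarith [hx.1, hx.2])] at h0
        have := mem_dyadicCell hΦ 0 (y + Φ / 2)
        rw [h0, pow_zero, div_one] at this
        constructor <;> linarith [this.1, this.2]
      refine ⟨Ioc_subset_Icc_self hy0, ?_⟩
      rw [branchIrrigation_eq hΦ hT hy0, branchIrrigation_eq hΦ hT hx,
        branchFlow_of_mem hT ⟨ht.1.le, ht.2.le⟩, branchFlow_of_mem hT ⟨ht.1.le, ht.2.le⟩, hyx,
        dyadicCenter_eq_of_le hΦ k.le_succ hyx]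
    rw [Measure.restrict_congr_set Ioc_ae_eq_Icc.symm]
    refine (setLIntegral_mono measurable_const hsub).trans ?_
    rw [setLIntegral_const, Real.volume_Ioc, ← ENNReal.ofReal_inv_of_pos (by positivity),
      ← ENNReal.ofReal_mul (by positivity)]
    apply ENNReal.ofReal_le_ofReal
    apply le_of_eq
    field_simp
    ring
  · rw [Measure.restrict_congr_set Ioc_ae_eq_Icc.symm]
    calc ∫⁻ x in Ioc (-(Φ / 2)) (Φ / 2), ∫⁻ t in Ioo 0 (effTime T lam),
          ‖deriv (fun s => branchIrrigation Φ T s x) t‖ₑ ^ 2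
        ≤ ∫⁻ x in Ioc (-(Φ / 2)) (Φ / 2), ENNReal.ofReal (3 * Φ ^ 2 / (8 * T)) := by
          refine setLIntegral_mono measurable_const fun x hx => ?_
          simp only [branchIrrigation_eq hΦ hT hx]
          refine le_trans ?_ (lintegral_branchVelocity_sq_le hΦ hT (x + Φ / 2))
          rw [← lintegral_branchVelocity_sq_eq hT]
          refine (setLIntegral_le_lintegral _ _).trans (lintegral_mono_ae ?_)
          filter_upwards [(countable_branchExceptional T).ae_notMem volume] with t ht
          rw [((hasDerivAt_branchFlow_of_notMem hΦ hT ht (x + Φ / 2)).sub_const _).deriv]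
      _ = _ := by
        rw [setLIntegral_const, Real.volume_Ioc, ← ENNReal.ofReal_mul (by positivity)]
        congr 1
        ring

/-- The irrigation of `[-Φ/2, Φ/2]` that stays at the origin until time `T` and then moves at
constant speed. -/
def lateIrrigation (T lam t x : ℝ) : ℝ := lam * x * max 0 (t - T)

theorem lipschitzWith_lateIrrigation (T lam x : ℝ) :
    LipschitzWith ‖lam * x‖₊ fun t => lateIrrigation T lam t x := by
  refine LipschitzWith.of_dist_le_mul fun s t => ?_
  rw [lateIrrigation, lateIrrigation, Real.dist_eq, ← mul_sub, abs_mul, coe_nnnorm,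
    Real.norm_eq_abs]
  gcongr
  refine (abs_max_sub_max_le_max _ _ _ _).trans ?_
  simp [Real.dist_eq]

theorem isIrrigation_lateIrrigation {Φ T lam : ℝ} (hT : 0 < T) (hl : 0 < lam) :
    IsIrrigation Φ (effTime T lam) 0 (lateIrrigation T lam) where
  aemeasurable := by
    refine Measurable.aemeasurable ?_
    unfold Function.uncurry lateIrrigation
    fun_prop
  start x _ := by simp [lateIrrigation, hT.le]
  finish x _ := by
    simp only [lateIrrigation, effTime, add_sub_cancel_left, max_eq_right (inv_pos.2 hl).le]
    field_simp
  absCont := .of_forall fun x =>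
    (lipschitzWith_lateIrrigation T lam x).lipschitzOnWith.absolutelyContinuousOnInterval

/-- Before `T` there is a single branch of multiplicity `Φ`; afterwards each curve has speed at most
`lam * Φ` during a time `lam⁻¹`. -/
theorem lagrangianEnergy_lateIrrigation_le {Φ T lam : ℝ} (hΦ : 0 < Φ) (hT : 0 < T) (hl : 0 < lam) :
    lagrangianEnergy Φ T lam (lateIrrigation T lam) ≤ ENNReal.ofReal (T + lam * Φ ^ 3) := by
  have hvol : volume (Icc (-(Φ / 2)) (Φ / 2)) = ENNReal.ofReal Φ := by
    rw [Real.volume_Icc]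
    congr 1
    ring
  rw [ENNReal.ofReal_add hT.le (by positivity)]
  refine add_le_add ?_ ?_
  · calc _ ≤ ∫⁻ t in Ioo 0 T, 1 := by
          refine setLIntegral_mono measurable_const fun t ht => ?_
          have h0 : ∀ x, lateIrrigation T lam t x = 0 := fun x => by
            rw [lateIrrigation, max_eq_left (by linarith [ht.2]), mul_zero]
          simp only [curveMultiplicity, h0, and_true]
          rw [ofPred_mem_eq, setLIntegral_const, hvol]
          exact ENNReal.inv_mul_le_one _
      _ = _ := by simp
  · calc _ ≤ ∫⁻ x in Icc (-(Φ / 2)) (Φ / 2), ENNReal.ofReal (lam * Φ ^ 2) := by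
          refine setLIntegral_mono measurable_const fun x hx => ?_
          calc _ ≤ ∫⁻ t, (Icc T (effTime T lam)).indicator
                  (fun _ => ENNReal.ofReal ((lam * Φ) ^ 2)) t := by
                rw [← lintegral_indicator measurableSet_Ioo]
                refine lintegral_mono fun t => ?_
                by_cases ht : t ∈ Ioo 0 (effTime T lam)
                · rw [indicator_of_mem ht]
                  rcases lt_or_ge t T with h | h
                  · have : deriv (fun s => lateIrrigation T lam s x) t = 0 := by
                      refine ((hasDerivAt_const t (0 : ℝ)).congr_of_eventuallyEq ?_).deriv
                      filter_upwards [Iio_mem_nhds h] with s hs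
                      rw [lateIrrigation, max_eq_left (by linarith [mem_Iio.1 hs]), mul_zero]
                    simp [this]
                  · rw [indicator_of_mem (mem_Icc.2 ⟨h, ht.2.le⟩), ← ofReal_norm,
                      ← ENNReal.ofReal_pow (norm_nonneg _)]
                    refine ENNReal.ofReal_le_ofReal ?_
                    gcongr
                    -- The Lipschitz bound also covers the kink at `t = T`, where no case
                    -- distinction is then needed.
                    refine (norm_deriv_le_of_lipschitz (lipschitzWith_lateIrrigation T lam x)).trans ?_
                    rw [coe_nnnorm, norm_mul, Real.norm_of_nonneg hl.le, Real.norm_eq_abs]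
                    gcongr
                    rw [abs_le]
                    constructor <;> linarith [hx.1, hx.2]
                · rw [indicator_of_notMem ht]
                  exact zero_le
            _ = _ := by
              rw [lintegral_indicator measurableSet_Icc, setLIntegral_const, Real.volume_Icc,
                ← ENNReal.ofReal_mul (by positivity), effTime]
              congr 1
              field_simp
              ring
      _ = _ := by
        rw [setLIntegral_const, hvol, ← ENNReal.ofReal_mul (by positivity)]
        congr 1
        ring

theorem irrigationCost_bounds {Φ T lam : ℝ} (hΦ : 0 < Φ) (hT : 0 < T) (hl : 0 < lam) :
    ENNReal.ofReal (1 / 12 * (T + lam * Φ ^ 3 / (1 + lam * T))) ≤ irrigationCost Φ T lam ∧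
      irrigationCost Φ T lam ≤ ENNReal.ofReal (4 * (T + lam * Φ ^ 3 / (1 + lam * T))) := by
  constructor
  · refine le_iInf₂ fun X hX => le_trans (ENNReal.ofReal_le_ofReal ?_)
      (ofReal_le_lagrangianEnergy hΦ hT hl hX)
    have : Φ ^ 3 / (12 * effTime T lam) = 1 / 12 * (lam * Φ ^ 3 / (1 + lam * T)) := by
      unfold effTime
      field_simp
      ring
    rw [this]
    linarith
  -- The waiting competitor is efficient when `1 + lam * T ≤ 2`, the branching one when `1 + lam * T
  -- ≤ 2 * (lam * T)`.
  · rcases le_total (lam * T) 1 with h | h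
    · refine (iInf₂_le _ (isIrrigation_lateIrrigation hT hl)).trans
        ((lagrangianEnergy_lateIrrigation_le hΦ hT hl).trans (ENNReal.ofReal_le_ofReal ?_))
      have : lam * Φ ^ 3 / 2 ≤ lam * Φ ^ 3 / (1 + lam * T) := by gcongr; linarith
      have : 0 < lam * Φ ^ 3 := by positivity
      linarith
    · refine (iInf₂_le _ (isIrrigation_branchIrrigation hΦ hT ?_)).trans
        ((lagrangianEnergy_branchIrrigation_le hΦ hT).trans (ENNReal.ofReal_le_ofReal ?_))
      · unfold effTime
        linarith [inv_pos.2 hl]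
      have h2 : lam * Φ ^ 3 / (lam * T + lam * T) ≤ lam * Φ ^ 3 / (1 + lam * T) := by gcongr
      have h3 : lam * Φ ^ 3 / (lam * T + lam * T) = Φ ^ 3 / T / 2 := by
        field_simp
        norm_num
      have h4 : Φ * (3 * Φ ^ 2 / (8 * T)) = 3 / 8 * (Φ ^ 3 / T) := by
        field_simp
      have : 0 < Φ ^ 3 / T := by positivity
      rw [h4]
      linarith

/-! ## Measures on the circle that are transported by a flow -/

/-- The representative in `(0, 1]` of a point of the circle. -/
def circleRep (y : UnitAddCircle) : ℝ := (AddCircle.measurableEquivIoc 1 0 y : ℝ)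

theorem measurable_circleRep : Measurable circleRep :=
  measurable_subtype_coe.comp (AddCircle.measurableEquivIoc (1 : ℝ) 0).measurable

@[simp] theorem coe_circleRep (y : UnitAddCircle) : (circleRep y : UnitAddCircle) = y :=
  AddCircle.coe_equivIoc (p := (1 : ℝ))

theorem circleRep_coe {x : ℝ} (hx : x ∈ Ioc 0 1) : circleRep (x : UnitAddCircle) = x :=
  congrArg Subtype.val (AddCircle.equivIoc_coe_eq (p := (1 : ℝ)) (a := 0) (by simpa using hx))

/-- Lebesgue measure on the fundamental domain `(0, 1]` of the circle. -/
def unitLebesgue : Measure ℝ := volume.restrict (Ioc 0 1)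

instance : IsProbabilityMeasure unitLebesgue := ⟨by simp [unitLebesgue]⟩

theorem map_coe_unitLebesgue :
    unitLebesgue.map ((↑) : ℝ → UnitAddCircle) = volume := by
  have := (UnitAddCircle.measurePreserving_mk 0).map_eq
  rwa [zero_add] at this

theorem measurable_coe_circle : Measurable ((↑) : ℝ → UnitAddCircle) := AddCircle.measurable_mk'

theorem edist_coe_circle_le (a b : ℝ) : edist (a : UnitAddCircle) (b : UnitAddCircle) ≤ ‖a - b‖ₑ := by
  rw [edist_eq_enorm_sub, ← AddCircle.coe_sub, ← ofReal_norm, ← ofReal_norm]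
  exact ENNReal.ofReal_le_ofReal (QuotientAddGroup.norm_mk_le_norm (S := AddSubgroup.zmultiples (1 : ℝ)))

/-- The kernel `t ↦ (Y t)_# 1`. -/
def flowKernel (Y : ℝ → ℝ → ℝ) (hY : Measurable (Function.uncurry Y)) :
    Kernel ℝ UnitAddCircle where
  toFun t := unitLebesgue.map fun x => (Y t x : UnitAddCircle)
  measurable' := by
    refine Measure.measurable_of_measurable_coe _ fun s hs => ?_
    have hm := measurable_coe_circle.comp hY
    have h : ∀ t, unitLebesgue.map (fun x => (Y t x : UnitAddCircle)) s
        = unitLebesgue (Prod.mk t ⁻¹' ((fun p : ℝ × ℝ => (Y p.1 p.2 : UnitAddCircle)) ⁻¹' s)) :=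
      fun t => Measure.map_apply (hm.comp measurable_prodMk_left) hs
    simp only [h]
    exact measurable_measure_prodMk_left (hm hs)

section Flow

variable {Y : ℝ → ℝ → ℝ} {hY : Measurable (Function.uncurry Y)}

theorem measurable_coe_flow (hY : Measurable (Function.uncurry Y)) (t : ℝ) :
    Measurable fun x => (Y t x : UnitAddCircle) :=
  (measurable_coe_circle.comp hY).comp measurable_prodMk_left

theorem flowKernel_apply (t : ℝ) :
    flowKernel Y hY t = unitLebesgue.map fun x => (Y t x : UnitAddCircle) := rfl

instance : IsMarkovKernel (flowKernel Y hY) :=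
  ⟨fun t => Measure.isProbabilityMeasure_map (measurable_coe_flow hY t).aemeasurable⟩

/-- The map `(t, x) ↦ (t, Y t x)`. -/
def flowGraph (Y : ℝ → ℝ → ℝ) (p : ℝ × ℝ) : ℝ × UnitAddCircle := (p.1, (Y p.1 p.2 : UnitAddCircle))

theorem measurable_flowGraph (hY : Measurable (Function.uncurry Y)) : Measurable (flowGraph Y) :=
  measurable_fst.prodMk (measurable_coe_circle.comp hY)

/-- This turns integrals over `Q_T` into integrals over time and labels, where Fubini can isolate
single trajectories. -/
theorem spaceTimeMeasure_flowKernel (T : ℝ) :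
    spaceTimeMeasure T (flowKernel Y hY)
      = ((volume.restrict (Ioo (-T) T)).prod unitLebesgue).map (flowGraph Y) := by
  ext s hs
  rw [spaceTimeMeasure, Measure.compProd_apply hs, Measure.map_apply (measurable_flowGraph hY) hs,
    Measure.prod_apply (measurable_flowGraph hY hs)]
  refine lintegral_congr fun t => ?_
  rw [flowKernel_apply, Measure.map_apply (measurable_coe_flow hY t) (measurable_prodMk_left hs)]
  rfl

theorem atoms_flowKernel_subset (t : ℝ) :
    {y | flowKernel Y hY t {y} ≠ 0} ⊆ (fun x => (Y t x : UnitAddCircle)) '' Ioc 0 1 := by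
  intro y hy
  by_contra h
  refine hy ?_
  rw [flowKernel_apply, Measure.map_apply (measurable_coe_flow hY t) (measurableSet_singleton y),
    unitLebesgue, Measure.restrict_apply (measurable_coe_flow hY t (measurableSet_singleton y))]
  convert! measure_empty (μ := (volume : Measure ℝ))
  ext x
  simp only [mem_inter_iff, mem_preimage, mem_singleton_iff, mem_empty_iff_false, iff_false]
  exact fun hx => h ⟨x, hx.2, hx.1⟩

theorem flowKernel_compl_image (t : ℝ) (hc : (Y t '' Ioc 0 1).Countable) :
    flowKernel Y hY t ((fun x => (Y t x : UnitAddCircle)) '' Ioc 0 1)ᶜ = 0 := by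
  have hc' : ((fun x => (Y t x : UnitAddCircle)) '' Ioc 0 1).Countable := by
    rw [← image_image (fun y : ℝ => (y : UnitAddCircle)) (Y t)]
    exact hc.image _
  rw [flowKernel_apply, Measure.map_apply (measurable_coe_flow hY t) hc'.measurableSet.compl,
    unitLebesgue, Measure.restrict_apply
      (measurable_coe_flow hY t hc'.measurableSet.compl)]
  convert! measure_empty (μ := (volume : Measure ℝ))
  ext x
  simp only [mem_inter_iff, mem_preimage, mem_compl_iff, mem_empty_iff_false, iff_false]
  exact fun hx => hx.1 ⟨x, hx.2, rfl⟩

/-- A flow that is continuous in time has traces, and coupling each particle with its label bounds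
their distance to the Lebesgue measure. -/
theorem boundaryCost_flowKernel_le (hYc : ∀ x, Continuous fun t => Y t x) {l : Filter ℝ} {t₀ : ℝ}
    (hl : l ≤ 𝓝 t₀) :
    boundaryCost l (flowKernel Y hY) ≤ ∫⁻ x in Ioc 0 1, ‖Y t₀ x - x‖ₑ ^ 2 := by
  have hint : ∀ (f : C(UnitAddCircle, ℝ)) (t : ℝ),
      ∫ y, f y ∂(flowKernel Y hY t) = ∫ x, f (Y t x : UnitAddCircle) ∂unitLebesgue := fun f t =>
    integral_map (measurable_coe_flow hY t).aemeasurable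
      f.continuous.measurable.aestronglyMeasurable
  have htrace : IsTraceAlong l (flowKernel Y hY) (flowKernel Y hY t₀) := by
    refine ⟨inferInstance, fun f => ?_⟩
    simp only [hint]
    refine Tendsto.mono_left (Continuous.tendsto ?_ t₀) hl
    refine continuous_of_dominated (bound := fun _ => ‖f‖) (fun t => ?_) (fun t => ?_)
      (integrable_const _) ?_
    · exact (f.continuous.measurable.comp (measurable_coe_flow hY t)).aestronglyMeasurable
    · exact .of_forall fun x => f.norm_coe_le_norm _
    · exact .of_forall fun x => f.continuous.comp ((AddCircle.continuous_mk' 1).comp (hYc x))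
  have hm : Measurable fun x : ℝ => ((Y t₀ x : UnitAddCircle), (x : UnitAddCircle)) :=
    (measurable_coe_flow hY t₀).prodMk measurable_coe_circle
  let π : Measure (UnitAddCircle × UnitAddCircle) :=
    unitLebesgue.map fun x : ℝ => ((Y t₀ x : UnitAddCircle), (x : UnitAddCircle))
  have hplan : π.fst = flowKernel Y hY t₀ ∧ π.snd = volume := by
    constructor
    · rw [Measure.fst, Measure.map_map measurable_fst hm]
      rfl
    · rw [Measure.snd, Measure.map_map measurable_snd hm]
      exact map_coe_unitLebesgue
  calc boundaryCost l (flowKernel Y hY)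
      ≤ wassersteinPerSq (flowKernel Y hY t₀) volume := iInf₂_le _ htrace
    _ ≤ ∫⁻ p, edist p.1 p.2 ^ 2 ∂π := iInf₂_le π hplan
    _ = ∫⁻ x, edist (Y t₀ x : UnitAddCircle) (x : UnitAddCircle) ^ 2 ∂unitLebesgue :=
      lintegral_map (by fun_prop) hm
    _ ≤ _ := by
      refine lintegral_mono fun x => ?_
      gcongr
      exact edist_coe_circle_le _ _

end Flow

/-! ### Calculus of test functions through their lift to the plane -/

namespace IsTestFunction

variable {T : ℝ} {ζ : ℝ → UnitAddCircle → ℝ}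

theorem hasFDerivAt (h : IsTestFunction T ζ) (p : ℝ × ℝ) :
    HasFDerivAt (fun p : ℝ × ℝ => ζ p.1 (p.2 : UnitAddCircle))
      (fderiv ℝ (fun p : ℝ × ℝ => ζ p.1 (p.2 : UnitAddCircle)) p) p :=
  (h.smooth.differentiable (by simp) p).hasFDerivAt

theorem deriv_time (h : IsTestFunction T ζ) (t x : ℝ) :
    deriv (fun s => ζ s (x : UnitAddCircle)) t
      = fderiv ℝ (fun p : ℝ × ℝ => ζ p.1 (p.2 : UnitAddCircle)) (t, x) (1, 0) := by
  have := HasFDerivAt.comp_hasDerivAt (f := fun s : ℝ => (s, x)) t (h.hasFDerivAt (t, x))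
    ((hasDerivAt_id t).prodMk (hasDerivAt_const t x))
  exact this.deriv

theorem deriv_space (h : IsTestFunction T ζ) (t x : ℝ) :
    deriv (fun k : ℝ => ζ t ((x : UnitAddCircle) + (k : UnitAddCircle))) 0
      = fderiv ℝ (fun p : ℝ × ℝ => ζ p.1 (p.2 : UnitAddCircle)) (t, x) (0, 1) := by
  have h0 := h.hasFDerivAt (t, x + 0)
  rw [add_zero] at h0
  have := HasFDerivAt.comp_hasDerivAt (f := fun k : ℝ => (t, x + k)) 0 (by simpa using h0)
    ((hasDerivAt_const (0 : ℝ) t).prodMk ((hasDerivAt_id (0 : ℝ)).const_add x))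
  exact this.deriv

theorem hasDerivAt_comp (h : IsTestFunction T ζ) {y : ℝ → ℝ} {w t : ℝ} (hy : HasDerivAt y w t) :
    HasDerivAt (fun s => ζ s (y s : UnitAddCircle))
      (deriv (fun s => ζ s (y t : UnitAddCircle)) t
        + w * deriv (fun k : ℝ => ζ t ((y t : UnitAddCircle) + (k : UnitAddCircle))) 0) t := by
  rw [h.deriv_time, h.deriv_space]
  convert! (h.hasFDerivAt (t, y t)).comp_hasDerivAt t ((hasDerivAt_id t).prodMk hy) using 1
  rw [show ((1 : ℝ), w) = (1, 0) + w • ((0 : ℝ), (1 : ℝ)) by simp, map_add, map_smul, smul_eq_mul]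

theorem continuous_fderiv_apply (h : IsTestFunction T ζ) (v : ℝ × ℝ) :
    Continuous fun p =>
      fderiv ℝ (fun p : ℝ × ℝ => ζ p.1 (p.2 : UnitAddCircle)) p v :=
  (h.smooth.continuous_fderiv (by simp)).clm_apply continuous_const

theorem measurable_deriv_time (h : IsTestFunction T ζ) :
    Measurable fun p : ℝ × UnitAddCircle => deriv (fun s => ζ s p.2) p.1 := by
  have : ∀ p : ℝ × UnitAddCircle, deriv (fun s => ζ s p.2) p.1
      = fderiv ℝ (fun p : ℝ × ℝ => ζ p.1 (p.2 : UnitAddCircle)) (p.1, circleRep p.2) (1, 0) :=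
    fun p => by rw [← h.deriv_time, coe_circleRep]
  simp only [this]
  exact (h.continuous_fderiv_apply _).measurable.comp
    (measurable_fst.prodMk (measurable_circleRep.comp measurable_snd))

theorem measurable_deriv_space (h : IsTestFunction T ζ) :
    Measurable fun p : ℝ × UnitAddCircle =>
      deriv (fun k : ℝ => ζ p.1 (p.2 + (k : UnitAddCircle))) 0 := by
  have : ∀ p : ℝ × UnitAddCircle, deriv (fun k : ℝ => ζ p.1 (p.2 + (k : UnitAddCircle))) 0
      = fderiv ℝ (fun p : ℝ × ℝ => ζ p.1 (p.2 : UnitAddCircle)) (p.1, circleRep p.2) (0, 1) :=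
    fun p => by rw [← h.deriv_space, coe_circleRep]
  simp only [this]
  exact (h.continuous_fderiv_apply _).measurable.comp
    (measurable_fst.prodMk (measurable_circleRep.comp measurable_snd))

theorem exists_deriv_bound (h : IsTestFunction T ζ) :
    ∃ C, ∀ t ∈ Ioo (-T) T, ∀ x : UnitAddCircle, ‖deriv (fun s => ζ s x) t‖ ≤ C ∧
      ‖deriv (fun k : ℝ => ζ t (x + (k : UnitAddCircle))) 0‖ ≤ C := by
  have hK : IsCompact (Icc (-T) T ×ˢ Icc (0 : ℝ) 1) := isCompact_Icc.prod isCompact_Icc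
  obtain ⟨C₁, h₁⟩ := hK.exists_bound_of_continuousOn (h.continuous_fderiv_apply (1, 0)).continuousOn
  obtain ⟨C₂, h₂⟩ := hK.exists_bound_of_continuousOn (h.continuous_fderiv_apply (0, 1)).continuousOn
  refine ⟨max C₁ C₂, fun t ht x => ?_⟩
  -- Periodicity reduces the bound to a fundamental domain, where compactness applies.
  have hx : circleRep x ∈ Ioc (0 : ℝ) 1 := by
    have h0 := (AddCircle.measurableEquivIoc (1 : ℝ) 0 x).2
    have h1 : circleRep x ≤ 0 + 1 := h0.2
    exact ⟨h0.1, by rwa [zero_add] at h1⟩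
  have hm : (t, circleRep x) ∈ Icc (-T) T ×ˢ Icc (0 : ℝ) 1 :=
    ⟨Ioo_subset_Icc_self ht, Ioc_subset_Icc_self hx⟩
  rw [← coe_circleRep x, h.deriv_time, h.deriv_space]
  exact ⟨(h₁ _ hm).trans (le_max_left _ _), (h₂ _ hm).trans (le_max_right _ _)⟩

end IsTestFunction

/-- A flow on the circle with velocity `W` along the trajectories, generated by the velocity
field `V`, with action at most `K` for each trajectory. -/
structure IsCircleFlow (T K : ℝ) (S : Set ℝ) (Y W : ℝ → ℝ → ℝ) (V : ℝ × UnitAddCircle → ℝ) :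
    Prop where
  measurable_flow : Measurable (Function.uncurry Y)
  measurable_velocity : Measurable (Function.uncurry W)
  measurable_field : Measurable V
  continuous_flow : ∀ x, Continuous fun t => Y t x
  countable : S.Countable
  hasDerivAt : ∀ t ∉ S, ∀ x, HasDerivAt (fun s => Y s x) (W t x) t
  field_eq : ∀ t ∈ Ioo (-T) T, t ∉ S → ∀ x ∈ Ioc 0 1, V (t, (Y t x : UnitAddCircle)) = W t x
  action_le : ∀ x, ∫⁻ t in Ioo (-T) T, ‖W t x‖ₑ ^ 2 ≤ ENNReal.ofReal K
  countable_image : ∀ t ∈ Ioo (-T) T, t ∉ S → (Y t '' Ioc 0 1).Countable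

namespace IsCircleFlow

variable {T K : ℝ} {S : Set ℝ} {Y W : ℝ → ℝ → ℝ} {V : ℝ × UnitAddCircle → ℝ}

theorem ae_notMem (h : IsCircleFlow T K S Y W V) :
    ∀ᵐ t ∂volume.restrict (Ioo (-T) T), t ∈ Ioo (-T) T ∧ t ∉ S := by
  filter_upwards [ae_restrict_mem measurableSet_Ioo,
    ae_restrict_of_ae (h.countable.ae_notMem volume)] with t h1 h2 using ⟨h1, h2⟩

theorem ae_field_eq (h : IsCircleFlow T K S Y W V) :
    ∀ᵐ p ∂(volume.restrict (Ioo (-T) T)).prod unitLebesgue,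
      p.1 ∈ Ioo (-T) T ∧ V (flowGraph Y p) = W p.1 p.2 := by
  have h1 := Measure.quasiMeasurePreserving_fst (μ := volume.restrict (Ioo (-T) T))
    (ν := unitLebesgue) |>.ae h.ae_notMem
  have h2 := Measure.quasiMeasurePreserving_snd (μ := volume.restrict (Ioo (-T) T))
    (ν := unitLebesgue) |>.ae (ae_restrict_mem measurableSet_Ioc)
  filter_upwards [h1, h2] with p hp hp'
  exact ⟨hp.1, h.field_eq p.1 hp.1 hp.2 p.2 hp'⟩

theorem lintegral_velocity_le (h : IsCircleFlow T K S Y W V) :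
    ∫⁻ p, ‖W p.1 p.2‖ₑ ^ 2 ∂(volume.restrict (Ioo (-T) T)).prod unitLebesgue
      ≤ ENNReal.ofReal K := by
  rw [lintegral_prod_symm' (fun p : ℝ × ℝ => ‖W p.1 p.2‖ₑ ^ 2)
    (h.measurable_velocity.enorm.pow_const 2)]
  refine (lintegral_mono h.action_le).trans_eq ?_
  rw [lintegral_const, measure_univ, mul_one]

theorem lintegral_field_le (h : IsCircleFlow T K S Y W V) :
    ∫⁻ p, ‖V p‖ₑ ^ 2 ∂(spaceTimeMeasure T (flowKernel Y h.measurable_flow))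
      ≤ ENNReal.ofReal K := by
  rw [spaceTimeMeasure_flowKernel, lintegral_map (h.measurable_field.enorm.pow_const 2)
    (measurable_flowGraph h.measurable_flow)]
  refine le_trans (lintegral_mono_ae ?_) h.lintegral_velocity_le
  filter_upwards [h.ae_field_eq] with p hp
  rw [hp.2]

/-- By the chain rule the integrand is the time derivative of the test function along the
trajectory, and the test function vanishes at both end times. -/
theorem integral_eq_zero (h : IsCircleFlow T K S Y W V) (hT : 0 < T)
    {ζ : ℝ → UnitAddCircle → ℝ} (hζ : IsTestFunction T ζ) (x : ℝ) :
    ∫ t in Ioo (-T) T, (deriv (fun s => ζ s (Y t x : UnitAddCircle)) t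
      + W t x * deriv (fun k : ℝ => ζ t ((Y t x : UnitAddCircle) + (k : UnitAddCircle))) 0) = 0 := by
  obtain ⟨C, hC⟩ := hζ.exists_deriv_bound
  obtain ⟨κ, hκ, -, hζκ⟩ := hζ.compactSupport
  have hYx : Measurable fun t => (t, (Y t x : UnitAddCircle)) :=
    measurable_id.prodMk (measurable_coe_circle.comp (h.continuous_flow x).measurable)
  have hWx : Measurable fun t => W t x := h.measurable_velocity.comp measurable_prodMk_right
  have hW : Integrable (fun t => W t x) (volume.restrict (Ioo (-T) T)) :=
    (memLp_two_of_lintegral_le hWx.aestronglyMeasurable (h.action_le x)).integrable one_le_two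
  have hi : IntegrableOn (fun t => deriv (fun s => ζ s (Y t x : UnitAddCircle)) t
      + W t x * deriv (fun k : ℝ => ζ t ((Y t x : UnitAddCircle) + (k : UnitAddCircle))) 0)
      (Ioo (-T) T) := by
    refine Integrable.add ?_ (Integrable.mul_bdd (c := C) hW ?_ ?_)
    · refine Integrable.of_bound (hζ.measurable_deriv_time.comp hYx).aestronglyMeasurable C ?_
      filter_upwards [ae_restrict_mem measurableSet_Ioo] with t ht using (hC t ht _).1
    · exact (hζ.measurable_deriv_space.comp hYx).aestronglyMeasurable
    · filter_upwards [ae_restrict_mem measurableSet_Ioo] with t ht using (hC t ht _).2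
  have hTT : -T ≤ T := by linarith
  rw [← integral_Ioc_eq_integral_Ioo, ← intervalIntegral.integral_of_le hTT,
    integral_eq_of_hasDerivAt_off_countable (fun t => ζ t (Y t x : UnitAddCircle)) _ h.countable
      ?_ (fun t ht => hζ.hasDerivAt_comp (h.hasDerivAt t ht.2 x)) ?_]
  · rw [hζκ T fun hm => lt_irrefl _ (hκ hm).2, hζκ (-T) fun hm => lt_irrefl _ (hκ hm).1, sub_zero]
  · exact (hζ.smooth.continuous.comp
      (continuous_id.prodMk (h.continuous_flow x))).continuousOn
  · rwa [intervalIntegrable_iff_integrableOn_Ioo_of_le hTT]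

/-- The continuity equation, written in labels and integrated first in time, vanishes trajectory by
trajectory. -/
theorem isAdmissiblePair (h : IsCircleFlow T K S Y W V) (hT : 0 < T) :
    IsAdmissiblePair T (flowKernel Y h.measurable_flow) V where
  finite := inferInstance
  integrable := by
    have : MemLp V 2 (spaceTimeMeasure T (flowKernel Y h.measurable_flow)) :=
      memLp_two_of_lintegral_le h.measurable_field.aestronglyMeasurable h.lintegral_field_le
    have : IsFiniteMeasure (spaceTimeMeasure T (flowKernel Y h.measurable_flow)) := by
      unfold spaceTimeMeasure; infer_instance
    exact MemLp.integrable one_le_two ‹_›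
  continuityEq ζ hζ := by
    obtain ⟨C, hC⟩ := hζ.exists_deriv_bound
    have hg := measurable_flowGraph h.measurable_flow
    have hmt := hζ.measurable_deriv_time
    have hms := hζ.measurable_deriv_space
    have hm : Measurable fun p : ℝ × UnitAddCircle => deriv (fun s => ζ s p.2) p.1
        + V p * deriv (fun k : ℝ => ζ p.1 (p.2 + (k : UnitAddCircle))) 0 :=
      hmt.add (h.measurable_field.mul hms)
    rw [spaceTimeMeasure_flowKernel, integral_map hg.aemeasurable hm.aestronglyMeasurable]
    have hcongr : (fun p => deriv (fun s => ζ s (flowGraph Y p).2) (flowGraph Y p).1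
          + V (flowGraph Y p) * deriv (fun k : ℝ =>
            ζ (flowGraph Y p).1 ((flowGraph Y p).2 + (k : UnitAddCircle))) 0)
        =ᵐ[(volume.restrict (Ioo (-T) T)).prod unitLebesgue]
        fun p => deriv (fun s => ζ s (Y p.1 p.2 : UnitAddCircle)) p.1
          + W p.1 p.2 * deriv (fun k : ℝ =>
            ζ p.1 ((Y p.1 p.2 : UnitAddCircle) + (k : UnitAddCircle))) 0 := by
      filter_upwards [h.ae_field_eq] with p hp
      rw [hp.2]
      rfl
    have hW : Integrable (fun p : ℝ × ℝ => W p.1 p.2)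
        ((volume.restrict (Ioo (-T) T)).prod unitLebesgue) :=
      (memLp_two_of_lintegral_le h.measurable_velocity.aestronglyMeasurable
        h.lintegral_velocity_le).integrable one_le_two
    rw [integral_congr_ae hcongr, integral_prod_symm]
    · simp only [h.integral_eq_zero hT hζ, integral_zero]
    · refine Integrable.add ?_ (Integrable.mul_bdd (c := C) hW ?_ ?_)
      · refine Integrable.of_bound (hmt.comp hg).aestronglyMeasurable C ?_
        filter_upwards [h.ae_field_eq] with p hp using (hC _ hp.1 _).1
      · exact (hms.comp hg).aestronglyMeasurable
      · filter_upwards [h.ae_field_eq] with p hp using (hC _ hp.1 _).2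
  atomic := by
    filter_upwards [h.ae_notMem] with t ht
    have hc := h.countable_image t ht.1 ht.2
    refine ⟨(fun x => (Y t x : UnitAddCircle)) '' Ioc 0 1, ?_, flowKernel_compl_image t hc⟩
    rw [← image_image (fun y : ℝ => (y : UnitAddCircle)) (Y t)]
    exact hc.image _

theorem minEnergy1d_le (h : IsCircleFlow T K S Y W V) (hT : 0 < T) (lam : ℝ) {b : ℝ≥0∞}
    (h₁ : ∫⁻ x in Ioc 0 1, ‖Y T x - x‖ₑ ^ 2 ≤ b) (h₂ : ∫⁻ x in Ioc 0 1, ‖Y (-T) x - x‖ₑ ^ 2 ≤ b) :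
    minEnergy1d lam T ≤ (∫⁻ t in Ioo (-T) T, (((Y t '' Ioc 0 1).encard : ℕ∞) : ℝ≥0∞))
      + ENNReal.ofReal K + ENNReal.ofReal lam * (b + b) := by
  have hadm := h.isAdmissiblePair hT
  refine (iInf₂_le (flowKernel Y h.measurable_flow) ⟨V, hadm⟩).trans (add_le_add ?_ ?_)
  · refine (iInf₂_le V hadm).trans (add_le_add (lintegral_mono fun t => ?_) h.lintegral_field_le)
    have := encard_le_encard (atoms_flowKernel_subset (hY := h.measurable_flow) t)
    rw [← image_image (fun y : ℝ => (y : UnitAddCircle)) (Y t)] at this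
    exact ENat.toENNReal_le.2 (this.trans (encard_image_le _ _))
  · gcongr
    · exact (boundaryCost_flowKernel_le h.continuous_flow
        (inf_le_left.trans nhdsWithin_le_nhds)).trans h₁
    · exact (boundaryCost_flowKernel_le h.continuous_flow
        (inf_le_left.trans nhdsWithin_le_nhds)).trans h₂

end IsCircleFlow

/-! ## Upper bound for the energy on the circle -/

/-- For `x` in the half-open interval `(0, 1]`, the ceiling of `x * (n * 2 ^ k)` lies between `1`
and `n * 2 ^ k`; the index `j` is that ceiling minus one. -/
theorem dyadicCenter_image_subset {n : ℕ} (hn : 0 < n) (k : ℕ) :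
    dyadicCenter (1 / n) k '' Ioc 0 1 ⊆
      (fun j : ℕ => ((j : ℝ) + 1 / 2) / (n * 2 ^ k)) '' Finset.range (n * 2 ^ k) := by
  rintro _ ⟨x, hx, rfl⟩
  have hn' : (0 : ℝ) < n := Nat.cast_pos.2 hn
  have hM : (0 : ℝ) < n * 2 ^ k := by positivity
  have hpos : 0 < ⌈x * (n * 2 ^ k)⌉ := Int.ceil_pos.2 (mul_pos hx.1 hM)
  have hle : ⌈x * (n * 2 ^ k)⌉ ≤ ((n * 2 ^ k : ℕ) : ℤ) := by
    rw [Int.ceil_le]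
    push_cast
    nlinarith [hx.2]
  obtain ⟨j, hj⟩ := Int.eq_ofNat_of_zero_le hpos.le
  refine ⟨j - 1, by simp only [Finset.coe_range, mem_Iio]; omega, ?_⟩
  have h1 : 1 ≤ j := by omega
  have hdiv : x / (1 / n / 2 ^ k) = x * (n * 2 ^ k) := by field_simp
  simp only [dyadicCenter, cellCenter, hdiv, hj, Nat.cast_sub h1]
  push_cast
  field_simp
  ring

theorem encard_dyadicCenter_image_le {n : ℕ} (hn : 0 < n) (k : ℕ) :
    (dyadicCenter (1 / n) k '' Ioc 0 1).encard ≤ ((n * 2 ^ k : ℕ) : ℕ∞) := by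
  refine (encard_le_encard (dyadicCenter_image_subset hn k)).trans
    ((encard_image_le _ _).trans ?_)
  rw [encard_coe_eq_coe_finsetCard, Finset.card_range]

theorem toENNReal_le_ofReal {a : ℕ∞} {m : ℕ} {r : ℝ} (h : a ≤ m) (hr : (m : ℝ) = r) :
    (a : ℝ≥0∞) ≤ ENNReal.ofReal r := by
  rw [← hr, ENNReal.ofReal_natCast]
  simpa using ENat.toENNReal_le.2 h

theorem isCircleFlow_static {n : ℕ} (hn : 0 < n) (T : ℝ) :
    IsCircleFlow T 0 ∅ (fun _ x => dyadicCenter (1 / n) 0 x) (fun _ _ => 0) (fun _ => 0) where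
  measurable_flow := (measurable_dyadicCenter _ 0).comp measurable_snd
  measurable_velocity := measurable_const
  measurable_field := measurable_const
  continuous_flow _ := continuous_const
  countable := countable_empty
  hasDerivAt t _ x := hasDerivAt_const t _
  field_eq _ _ _ _ _ := rfl
  action_le x := by simp
  countable_image _ _ _ :=
    (finite_of_encard_le_coe (encard_dyadicCenter_image_le hn 0)).countable

/-- The competitor keeps `n` equally spaced atoms at rest, so only the count and the Wasserstein
penalty are paid; each label is within `1 / n` of its centre. -/
theorem minEnergy1d_le_static {n : ℕ} (hn : 0 < n) {T lam : ℝ} (hT : 0 < T) (hl : 0 < lam) :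
    minEnergy1d lam T ≤ ENNReal.ofReal (2 * n * T + 2 * lam / n ^ 2) := by
  have hn' : (0 : ℝ) < n := Nat.cast_pos.2 hn
  have hb : ∫⁻ x in Ioc (0 : ℝ) 1, ‖dyadicCenter (1 / n) 0 x - x‖ₑ ^ 2
      ≤ ENNReal.ofReal ((1 / n) ^ 2) := by
    refine (setLIntegral_mono (g := fun _ => ENNReal.ofReal ((1 / n) ^ 2)) measurable_const
      fun x _ => ?_).trans_eq (by simp)
    rw [← ofReal_norm, ← ENNReal.ofReal_pow (norm_nonneg _), norm_sub_rev, Real.norm_eq_abs]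
    refine ENNReal.ofReal_le_ofReal ?_
    gcongr
    refine (abs_sub_dyadicCenter_le (by positivity) 0 x).trans ?_
    rw [pow_zero, div_one]
    exact half_le_self (by positivity)
  refine ((isCircleFlow_static hn T).minEnergy1d_le hT lam hb hb).trans ?_
  have hc : ((dyadicCenter (1 / n) 0 '' Ioc 0 1).encard : ℝ≥0∞) ≤ ENNReal.ofReal n :=
    toENNReal_le_ofReal (encard_dyadicCenter_image_le hn 0) (by simp)
  rw [setLIntegral_const, Real.volume_Ioo, ENNReal.ofReal_zero, add_zero,
    ← ENNReal.ofReal_add (by positivity) (by positivity), ← ENNReal.ofReal_mul hl.le,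
    ENNReal.ofReal_add (by positivity) (by positivity)]
  refine add_le_add ?_ (ENNReal.ofReal_le_ofReal (le_of_eq (by field_simp; norm_num)))
  calc _ ≤ ENNReal.ofReal n * ENNReal.ofReal (T - -T) := by gcongr
    _ = _ := by
      rw [← ENNReal.ofReal_mul hn'.le]
      congr 1
      ring

theorem lintegral_Ioo_neg_le_two_mul {f : ℝ → ℝ≥0∞} (hf : ∀ t, f (-t) = f t) (T : ℝ) :
    ∫⁻ t in Ioo (-T) T, f t ≤ 2 * ∫⁻ t in Ioo 0 T, f t := by
  have hneg : ∫⁻ t in Ioo (-T) 0, f t = ∫⁻ t in Ioo 0 T, f t := by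
    have := (Measure.measurePreserving_neg (volume : Measure ℝ)).setLIntegral_comp_preimage_emb
      (MeasurableEquiv.neg ℝ).measurableEmbedding f (Ioo 0 T)
    rw [← this]
    simp only [hf, neg_preimage, neg_Ioo, neg_zero]
  calc ∫⁻ t in Ioo (-T) T, f t
      ≤ ∫⁻ t in Ioc (-T) 0 ∪ Ioo 0 T, f t := by
        refine lintegral_mono_set fun t ht => ?_
        rcases le_or_gt t 0 with h | h
        · exact Or.inl ⟨ht.1, h⟩
        · exact Or.inr ⟨h, ht.2⟩
    _ ≤ (∫⁻ t in Ioc (-T) 0, f t) + ∫⁻ t in Ioo 0 T, f t := lintegral_union_le _ _ _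
    _ = _ := by
      rw [Measure.restrict_congr_set Ioo_ae_eq_Ioc.symm, hneg, two_mul]

/-- At a fixed time of stage `k` the position is a function of the centre of generation `k + 1`
alone, because that centre determines its parent. -/
theorem branchFlow_image_encard_le {n : ℕ} (hn : 0 < n) {T : ℝ} (hT : 0 < T) {k : ℕ} {t : ℝ}
    (ht : t ∈ Ioo (branchTime T k) (branchTime T (k + 1))) :
    (branchFlow (1 / n) T t '' Ioc 0 1).encard ≤ ((n * 2 ^ (k + 1) : ℕ) : ℕ∞) := by
  have hL : (0 : ℝ) < 1 / n := by positivity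
  have h : branchFlow (1 / n) T t = (fun c => dyadicCenter (1 / n) k c +
      (c - dyadicCenter (1 / n) k c) * ((t - branchTime T k) / branchDuration T k)) ∘
        dyadicCenter (1 / n) (k + 1) := by
    ext x
    rw [Function.comp_apply, branchFlow_of_mem hT ⟨ht.1.le, ht.2.le⟩,
      dyadicCenter_dyadicCenter_succ hL]
  rw [h, image_comp]
  exact (encard_image_le _ _).trans (encard_dyadicCenter_image_le hn (k + 1))

theorem dyadicCenter_mem_Ioc {n : ℕ} (hn : 0 < n) (k : ℕ) {x : ℝ} (hx : x ∈ Ioc 0 1) :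
    dyadicCenter (1 / n) k x ∈ Ioc (0 : ℝ) 1 := by
  obtain ⟨j, hj, h⟩ := dyadicCenter_image_subset hn k ⟨x, hx, rfl⟩
  have hn' : (0 : ℝ) < n := Nat.cast_pos.2 hn
  have hj' : (j : ℝ) + 1 ≤ n * 2 ^ k := by exact_mod_cast Finset.mem_range.1 hj
  rw [← h]
  refine ⟨by positivity, ?_⟩
  rw [div_le_one (by positivity)]
  linarith

/-- The position is a convex combination of two centres in `(0, 1]`. Staying in this fundamental
domain lets `circleRep` recover the real position from the point of the circle. -/
theorem branchFlow_mem_Ioc {n : ℕ} (hn : 0 < n) {T t x : ℝ} (ht : t ∈ Ico 0 T) (hx : x ∈ Ioc 0 1) :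
    branchFlow (1 / n) T t x ∈ Ioc (0 : ℝ) 1 := by
  have hT : 0 < T := ht.1.trans_lt ht.2
  obtain ⟨k, hk⟩ := exists_mem_stage ht
  have hd := branchDuration_pos hT k
  rw [branchFlow_of_mem hT ⟨hk.1, hk.2.le⟩, mul_comm]
  refine (convex_Ioc (0 : ℝ) 1).add_smul_sub_mem (dyadicCenter_mem_Ioc hn k hx)
    (dyadicCenter_mem_Ioc hn (k + 1) hx) ⟨div_nonneg (sub_nonneg.2 hk.1) hd.le, ?_⟩
  rw [div_le_one hd]
  linarith [branchTime_succ T k, hk.2]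

/-- Running the flow in `|t|` gathers the mass into `n` points at time `0` and reaches the identity
at `T` and `-T`. The sign is the derivative of `|t|`, and the action is twice that of one half. -/
theorem isCircleFlow_branch {n : ℕ} (hn : 0 < n) {T : ℝ} (hT : 0 < T) :
    IsCircleFlow T (3 / (4 * n ^ 2 * T)) (branchExceptional T ∪ Neg.neg '' branchExceptional T)
      (fun t x => branchFlow (1 / n) T |t| x)
      (fun t x => SignType.sign t * branchVelocity (1 / n) T |t| x)
      (fun p => SignType.sign p.1 * branchVelocity (1 / n) T |p.1| (circleRep p.2)) := by
  have hL : (0 : ℝ) < 1 / n := by positivity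
  have hsign : Measurable fun t : ℝ => ((SignType.sign t : SignType) : ℝ) := by
    have : (fun t : ℝ => ((SignType.sign t : SignType) : ℝ))
        = fun t => if 0 < t then 1 else if t < 0 then -1 else 0 := by
      ext t
      rw [sign_apply]
      split_ifs <;> simp
    rw [this]
    exact Measurable.ite measurableSet_Ioi measurable_const
      (Measurable.ite measurableSet_Iio measurable_const measurable_const)
  have habs : ∀ t : ℝ, t ∉ branchExceptional T ∪ Neg.neg '' branchExceptional T →
      |t| ∉ branchExceptional T := by
    intro t ht h
    rcases abs_choice t with h' | h'
    · exact ht (Or.inl (h' ▸ h))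
    · exact ht (Or.inr ⟨|t|, h, by rw [h', neg_neg]⟩)
  have h0 : ∀ t : ℝ, t ∉ branchExceptional T ∪ Neg.neg '' branchExceptional T → t ≠ 0 :=
    fun t ht h => ht (Or.inl (Or.inr ⟨0, by rw [branchTime_zero, h]⟩))
  have hmem : ∀ t ∈ Ioo (-T) T, t ∉ branchExceptional T ∪ Neg.neg '' branchExceptional T →
      ∃ k, |t| ∈ Ioo (branchTime T k) (branchTime T (k + 1)) := fun t ht hS =>
    exists_mem_Ioo_stage ⟨abs_pos.2 (h0 t hS), abs_lt.2 ht⟩ (habs t hS)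
  refine
    { measurable_flow := Measurable.branchFlow hL measurable_fst.abs measurable_snd
      measurable_velocity := (hsign.comp measurable_fst).mul
        (Measurable.branchVelocity hT measurable_fst.abs measurable_snd)
      measurable_field := (hsign.comp measurable_fst).mul
        (Measurable.branchVelocity hT measurable_fst.abs (measurable_circleRep.comp measurable_snd))
      continuous_flow := fun x => (continuous_branchFlow hL T x).comp continuous_abs
      countable := (countable_branchExceptional T).union ((countable_branchExceptional T).image _)
      hasDerivAt := fun t ht x => ?_
      field_eq := fun t ht hS x hx => ?_
      action_le := fun x => ?_
      countable_image := fun t ht hS => ?_ }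
  · rw [mul_comm]
    exact (hasDerivAt_branchFlow_of_notMem hL hT (habs t ht) x).comp t (hasDerivAt_abs (h0 t ht))
  · obtain ⟨k, hk⟩ := hmem t ht hS
    simp only
    rw [circleRep_coe (branchFlow_mem_Ioc hn ⟨abs_nonneg t, abs_lt.2 ht⟩ hx),
      branchVelocity_branchFlow hL hT hk]
  · calc ∫⁻ t in Ioo (-T) T, ‖SignType.sign t * branchVelocity (1 / n) T |t| x‖ₑ ^ 2
        ≤ ∫⁻ t in Ioo (-T) T, ‖branchVelocity (1 / n) T |t| x‖ₑ ^ 2 := by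
          refine lintegral_mono fun t => ?_
          rw [enorm_mul]
          refine pow_le_pow_left₀ zero_le (mul_le_of_le_one_left zero_le ?_) 2
          rcases SignType.sign t with _ | _ | _ <;> simp
      _ ≤ 2 * ∫⁻ t in Ioo 0 T, ‖branchVelocity (1 / n) T |t| x‖ₑ ^ 2 :=
          lintegral_Ioo_neg_le_two_mul (fun t => by rw [abs_neg]) T
      _ = 2 * ∫⁻ t in Ioo 0 T, ‖branchVelocity (1 / n) T t x‖ₑ ^ 2 := by
          congr 1
          refine setLIntegral_congr_fun measurableSet_Ioo fun t ht => ?_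
          simp only [abs_of_pos ht.1]
      _ ≤ 2 * ENNReal.ofReal (3 * (1 / n) ^ 2 / (8 * T)) := by
          gcongr
          exact lintegral_branchVelocity_sq_le hL hT x
      _ = _ := by
          rw [show (2 : ℝ≥0∞) = ENNReal.ofReal 2 by simp, ← ENNReal.ofReal_mul zero_le_two]
          congr 1
          field_simp
          norm_num
  · obtain ⟨k, hk⟩ := hmem t ht hS
    exact (finite_of_encard_le_coe (branchFlow_image_encard_le hn hT hk)).countable

/-- The reflected tree ends exactly at Lebesgue measure, so the boundary terms vanish whatever `lam`
is. -/
theorem minEnergy1d_le_branch {n : ℕ} (hn : 0 < n) {T : ℝ} (hT : 0 < T) (lam : ℝ) :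
    minEnergy1d lam T ≤ ENNReal.ofReal (8 * n * T + 3 / (4 * n ^ 2 * T)) := by
  have hL : (0 : ℝ) < 1 / n := by positivity
  have hb : ∀ t, |t| = T → ∫⁻ x in Ioc (0 : ℝ) 1, ‖branchFlow (1 / n) T |t| x - x‖ₑ ^ 2 ≤ 0 := by
    intro t ht
    simp only [ht, branchFlow_of_le hL hT le_rfl, sub_self, enorm_zero]
    simp
  refine ((isCircleFlow_branch hn hT).minEnergy1d_le hT lam (hb T (abs_of_pos hT))
    (hb (-T) (by rw [abs_neg, abs_of_pos hT]))).trans ?_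
  rw [add_zero, mul_zero, add_zero, ENNReal.ofReal_add (by positivity) (by positivity)]
  refine add_le_add ?_ le_rfl
  calc ∫⁻ t in Ioo (-T) T, (((branchFlow (1 / n) T |t| '' Ioc 0 1).encard : ℕ∞) : ℝ≥0∞)
      ≤ 2 * ∫⁻ t in Ioo 0 T, (((branchFlow (1 / n) T |t| '' Ioc 0 1).encard : ℕ∞) : ℝ≥0∞) :=
        lintegral_Ioo_neg_le_two_mul (fun t => by rw [abs_neg]) T
    _ ≤ 2 * ENNReal.ofReal (4 * n * T) := by
        gcongr
        refine lintegral_branch_count_le hT (Nat.cast_nonneg n) fun k t ht => ?_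
        rw [abs_of_nonneg ((branchTime_nonneg hT k).trans ht.1.le)]
        exact toENNReal_le_ofReal (branchFlow_image_encard_le hn hT ht) (by push_cast; ring)
    _ = _ := by
        rw [show (2 : ℝ≥0∞) = ENNReal.ofReal 2 by simp, ← ENNReal.ofReal_mul zero_le_two]
        congr 1
        ring

theorem exists_nat_one_div_sq_le {r : ℝ} (hr : 0 < r) :
    ∃ n : ℕ, 0 < n ∧ (n : ℝ) ≤ 1 + r ∧ 1 / (n : ℝ) ^ 2 ≤ 1 / r ^ 2 := by
  refine ⟨⌈r⌉₊, Nat.ceil_pos.2 hr, ?_, ?_⟩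
  · linarith [Nat.ceil_lt_add_one hr.le]
  · gcongr
    exact Nat.le_ceil r

theorem minEnergy1d_le {T lam : ℝ} (hT : 0 < T) (hl : 0 < lam) :
    minEnergy1d lam T ≤ ENNReal.ofReal
      (10 * (T + min (T ^ (1 / 3 : ℝ)) (lam ^ (1 / 3 : ℝ) * T ^ (2 / 3 : ℝ)))) := by
  set a := T ^ (1 / 3 : ℝ) with ha
  set b := lam ^ (1 / 3 : ℝ) with hb
  have ha0 : 0 < a := by positivity
  have hb0 : 0 < b := by positivity
  have hT3 : T = a ^ 3 := by
    rw [ha, ← Real.rpow_natCast, ← Real.rpow_mul hT.le]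
    norm_num
  have hl3 : lam = b ^ 3 := by
    rw [hb, ← Real.rpow_natCast, ← Real.rpow_mul hl.le]
    norm_num
  have hT2 : T ^ (2 / 3 : ℝ) = a ^ 2 := by
    rw [ha, ← Real.rpow_natCast, ← Real.rpow_mul hT.le]
    norm_num
  rw [hT2]
  rcases le_total a (b * a ^ 2) with h | h
  -- The optimal number of trees is of order `T ^ (-2/3)`, which balances `n T` against `1 / (n ^ 2
  -- T)`.
  · obtain ⟨n, hn, h1, h2⟩ := exists_nat_one_div_sq_le (r := 1 / a ^ 2) (by positivity)
    refine (minEnergy1d_le_branch hn hT lam).trans (ENNReal.ofReal_le_ofReal ?_)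
    rw [min_eq_left h]
    have e1 : 8 * n * T ≤ 8 * (1 + 1 / a ^ 2) * T := by gcongr
    have e2 : 3 / (4 * n ^ 2 * T) ≤ 3 / 4 * a := by
      calc 3 / (4 * n ^ 2 * T) = 3 / 4 * (1 / (n : ℝ) ^ 2) / T := by field_simp
        _ ≤ 3 / 4 * (1 / (1 / a ^ 2) ^ 2) / T := by gcongr
        _ = 3 / 4 * a := by rw [hT3]; field_simp
    have e3 : 8 * (1 + 1 / a ^ 2) * T = 8 * T + 8 * a := by rw [hT3]; field_simp
    linarith
  -- The optimal number of atoms is of order `(lam / T) ^ (1/3)`, which balances `n T` against `lam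
  -- / n ^ 2`.
  · obtain ⟨n, hn, h1, h2⟩ := exists_nat_one_div_sq_le (r := b / a) (by positivity)
    refine (minEnergy1d_le_static hn hT hl).trans (ENNReal.ofReal_le_ofReal ?_)
    rw [min_eq_right h]
    have e1 : 2 * n * T ≤ 2 * (1 + b / a) * T := by gcongr
    have e2 : 2 * lam / n ^ 2 ≤ 2 * (b * a ^ 2) := by
      calc 2 * lam / n ^ 2 = 2 * lam * (1 / (n : ℝ) ^ 2) := by ring
        _ ≤ 2 * lam * (1 / (b / a) ^ 2) := by gcongr
        _ = 2 * (b * a ^ 2) := by rw [hl3]; field_simp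
    have e3 : 2 * (1 + b / a) * T = 2 * T + 2 * (b * a ^ 2) := by rw [hT3]; field_simp
    have : 0 < b * a ^ 2 := by positivity
    linarith

/-! ## Weak derivatives on an interval -/

theorem integrableOn_mul_of_hasCompactSupport {g w : ℝ → ℝ} {s : Set ℝ} (hg : Continuous g)
    (hgc : HasCompactSupport g) (hw : IntegrableOn w s) : IntegrableOn (fun t => g t * w t) s := by
  obtain ⟨C, hC⟩ := hgc.exists_bound_of_continuous hg
  exact Integrable.bdd_mul (c := C) hw hg.aestronglyMeasurable (.of_forall hC)

/-- This is the du Bois-Reymond lemma. Subtracting from a test function the multiple of a fixed bump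
`ρ` with the same integral leaves a function of mean zero, whose primitive has compact support and
is an allowed test function. The constant is forced to be the `ρ`-average of `w`. -/
theorem ae_eq_const_of_integral_deriv_mul_eq_zero {a b : ℝ} (hab : a < b) {w : ℝ → ℝ}
    (hw : IntegrableOn w (Ioo a b))
    (h : ∀ η : ℝ → ℝ, ContDiff ℝ ∞ η → HasCompactSupport η → tsupport η ⊆ Ioo a b →
      ∫ t in Ioo a b, deriv η t * w t = 0) :
    ∃ c, ∀ᵐ t, t ∈ Ioo a b → w t = c := by
  let φ : ContDiffBump ((a + b) / 2) :=
    ⟨(b - a) / 8, (b - a) / 4, by linarith, by linarith⟩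
  set ρ : ℝ → ℝ := φ.normed volume with hρ
  have hρs : ContDiff ℝ ∞ ρ := φ.contDiff_normed
  have hρc : HasCompactSupport ρ := φ.hasCompactSupport_normed
  have hρI : ∫ t, ρ t = 1 := φ.integral_normed
  have hρU : tsupport ρ ⊆ Ioo a b := by
    rw [hρ, φ.tsupport_normed_eq, Real.closedBall_eq_Icc]
    intro t ht
    simp only [φ, mem_Icc] at ht
    constructor <;> linarith [ht.1, ht.2]
  refine ⟨∫ t in Ioo a b, ρ t * w t, ?_⟩
  set c := ∫ t in Ioo a b, ρ t * w t with hc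
  have hcI : IntegrableOn (fun _ => c) (Ioo a b) := integrableOn_const (by simp)
  have key := isOpen_Ioo.ae_eq_zero_of_integral_contDiff_smul_eq_zero (μ := volume)
    (f := fun t => w t - c) (U := Ioo a b) (hw.sub hcI).locallyIntegrableOn ?_
  · filter_upwards [key] with t ht htU using sub_eq_zero.1 (ht htU)
  intro g hg hgc hgU
  set m := ∫ t, g t with hm
  set ψ : ℝ → ℝ := fun t => g t - m * ρ t with hψ
  have hψs : ContDiff ℝ ∞ ψ := hg.sub (contDiff_const.mul hρs)
  have hψ0 : ∀ t, t ∉ tsupport g ∪ tsupport ρ → ψ t = 0 := by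
    intro t ht
    rw [mem_union, not_or] at ht
    simp [hψ, image_eq_zero_of_notMem_tsupport ht.1, image_eq_zero_of_notMem_tsupport ht.2]
  have hKc : IsCompact (tsupport g ∪ tsupport ρ) := hgc.isCompact.union hρc.isCompact
  have hKU : tsupport g ∪ tsupport ρ ⊆ Ioo a b := union_subset hgU hρU
  have hKne : (tsupport g ∪ tsupport ρ).Nonempty := by
    by_contra hne
    rw [not_nonempty_iff_eq_empty, union_empty_iff] at hne
    have : ρ = 0 := tsupport_eq_empty_iff.1 hne.2
    simp [this] at hρI
  -- The extreme points of the two supports bound the support of the primitive: to their left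
  -- nothing has been integrated, to their right the whole zero integral has.
  obtain ⟨a', ha'⟩ := hKc.exists_isLeast hKne
  obtain ⟨b', hb'⟩ := hKc.exists_isGreatest hKne
  have haa := (hKU ha'.1).1
  have hbb := (hKU hb'.1).2
  have hψI : ∫ t, ψ t = 0 := by
    rw [hψ, integral_sub (hg.continuous.integrable_of_hasCompactSupport hgc)
      ((hρs.continuous.integrable_of_hasCompactSupport hρc).const_mul m), integral_const_mul, hρI,
      mul_one, sub_self]
  set η : ℝ → ℝ := fun t => ∫ s in a..t, ψ s with hη
  have hηd : ∀ t, HasDerivAt η (ψ t) t := fun t =>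
    intervalIntegral.integral_hasDerivAt_right (hψs.continuous.intervalIntegrable _ _)
      (hψs.continuous.stronglyMeasurableAtFilter _ _) hψs.continuous.continuousAt
  have hηderiv : deriv η = ψ := funext fun t => (hηd t).deriv
  have hηs : ContDiff ℝ ∞ η := by
    rw [contDiff_infty_iff_deriv, hηderiv]
    exact ⟨fun t => (hηd t).differentiableAt, hψs⟩
  have hη0 : ∀ t, t ∉ Icc a' b' → η t = 0 := by
    intro t ht
    rcases lt_or_ge t a' with h1 | h1
    · refine intervalIntegral.integral_zero_ae (.of_forall fun s hs => hψ0 s fun hsK => ?_)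
      have h2 : s ≤ max a t := (uIoc_subset_uIcc hs).2
      have h3 := ha'.2 hsK
      exact absurd (h2.trans_lt (max_lt haa h1)) (not_lt.2 h3)
    · have h2 : b' < t := not_le.1 fun h2 => ht ⟨h1, h2⟩
      rw [hη, ← hψI]
      refine intervalIntegral.integral_eq_integral_of_support_subset fun s hs => ?_
      have hsK : s ∈ tsupport g ∪ tsupport ρ := by
        by_contra hsK
        exact hs (hψ0 s hsK)
      exact ⟨(hKU hsK).1, (hb'.2 hsK).trans h2.le⟩
  have hηsupp : Function.support η ⊆ Icc a' b' := fun t ht => by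
    by_contra h'
    exact ht (hη0 t h')
  have hηt : tsupport η ⊆ Icc a' b' := closure_minimal hηsupp isClosed_Icc
  have hη := h η hηs (isCompact_Icc.of_isClosed_subset (isClosed_tsupport η) hηt)
    (hηt.trans fun t ht => ⟨haa.trans_le ht.1, ht.2.trans_lt hbb⟩)
  have hgw := integrableOn_mul_of_hasCompactSupport hg.continuous hgc hw
  have hρw := integrableOn_mul_of_hasCompactSupport hρs.continuous hρc hw
  have hgi : IntegrableOn g (Ioo a b) :=
    (hg.continuous.integrable_of_hasCompactSupport hgc).integrableOn
  have hgm : ∫ t in Ioo a b, g t = m :=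
    setIntegral_eq_integral_of_forall_compl_eq_zero fun t ht =>
      image_eq_zero_of_notMem_tsupport fun h' => ht (hgU h')
  rw [← setIntegral_eq_integral_of_forall_compl_eq_zero (s := Ioo a b)]
  · have e1 : ∫ t in Ioo a b, g t • (w t - c) = (∫ t in Ioo a b, g t * w t) - m * c := by
      rw [← hgm, ← integral_mul_const, ← integral_sub hgw (hgi.mul_const c)]
      simp only [smul_eq_mul, mul_sub]
    have e2 : ∫ t in Ioo a b, deriv η t * w t = (∫ t in Ioo a b, g t * w t) - m * c := by
      rw [hηderiv, hc, ← integral_const_mul, ← integral_sub hgw (hρw.const_mul m)]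
      refine integral_congr_ae (.of_forall fun t => ?_)
      simp only [hψ]
      ring
    rw [e1, ← e2, hη]
  · intro t ht
    rw [image_eq_zero_of_notMem_tsupport fun h' => ht (hgU h'), zero_smul]

/-- A function with an integrable weak derivative is almost everywhere equal to a primitive. -/
theorem ae_eq_add_integral_of_weak_deriv {a b : ℝ} (hab : a < b) {u h : ℝ → ℝ}
    (hu : IntegrableOn u (Ioo a b)) (hh : IntegrableOn h (Ioo a b))
    (hweak : ∀ η : ℝ → ℝ, ContDiff ℝ ∞ η → HasCompactSupport η → tsupport η ⊆ Ioo a b →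
      ∫ t in Ioo a b, (deriv η t * u t + η t * h t) = 0) :
    ∃ c, ∀ᵐ t, t ∈ Ioo a b → u t = c + ∫ s in a..t, h s := by
  have hhi : IntervalIntegrable h volume a b := by
    rwa [intervalIntegrable_iff_integrableOn_Ioo_of_le hab.le]
  have hHac := hhi.absolutelyContinuousOnInterval_intervalIntegral (c := a) left_mem_uIcc
  set H : ℝ → ℝ := fun t => ∫ s in a..t, h s with hH
  have hHi : IntegrableOn H (Ioo a b) := by
    have := hHac.continuousOn
    rw [uIcc_of_le hab.le] at this
    exact this.integrableOn_Icc.mono_set Ioo_subset_Icc_self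
  have hder : ∀ᵐ t, t ∈ uIoc a b → deriv H t = h t := by
    filter_upwards [hhi.ae_hasDerivAt_integral] with t ht htm
    exact (ht (uIoc_subset_uIcc htm) a left_mem_uIcc).deriv
  -- Integration by parts shows that `u - H` has zero weak derivative.
  obtain ⟨c, hc⟩ := ae_eq_const_of_integral_deriv_mul_eq_zero hab (w := fun t => u t - H t)
    (hu.sub hHi) fun η hη hηc hηU => by
      have hdc : HasCompactSupport (deriv η) := hηc.deriv
      have hdcont : Continuous (deriv η) := hη.continuous_deriv (by simp)
      have i1 := integrableOn_mul_of_hasCompactSupport hdcont hdc hu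
      have i2 := integrableOn_mul_of_hasCompactSupport hdcont hdc hHi
      have i3 := integrableOn_mul_of_hasCompactSupport hη.continuous hηc hh
      have hηab : ∀ t, t ∉ Ioo a b → η t = 0 := fun t ht =>
        image_eq_zero_of_notMem_tsupport fun h' => ht (hηU h')
      have hparts : ∫ t in Ioo a b, η t * h t = -∫ t in Ioo a b, deriv η t * H t := by
        have hηac : AbsolutelyContinuousOnInterval η a b :=
          (hη.of_le (by simp) : ContDiff ℝ 1 η).contDiffOn.absolutelyContinuousOnInterval
        have := hηac.integral_mul_deriv_eq_deriv_mul hHac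
        rw [hηab a (by simp), hηab b (by simp), zero_mul, zero_mul, sub_zero, zero_sub] at this
        rw [← integral_Ioc_eq_integral_Ioo, ← integral_Ioc_eq_integral_Ioo,
          ← intervalIntegral.integral_of_le hab.le, ← intervalIntegral.integral_of_le hab.le, ← this]
        refine intervalIntegral.integral_congr_ae ?_
        filter_upwards [hder] with t ht htm
        rw [ht htm]
      have h0 := hweak η hη hηc hηU
      rw [integral_add i1 i3, hparts] at h0
      simp only [mul_sub]
      rw [integral_sub i1 i2]
      linarith
  refine ⟨c, ?_⟩
  filter_upwards [hc] with t ht htm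
  linarith [ht htm]

/-! ## Smoothing Lipschitz functions on the circle -/

/-- Convolve the lift with a bump of unit mass supported in a ball of radius `ε`. Translations are
isometries, so the Lipschitz bound survives, and each value moves by at most `ε`. -/
theorem exists_smooth_near_of_lipschitz {g : UnitAddCircle → ℝ}
    (hg : ∀ x y, |g x - g y| ≤ dist x y) {ε : ℝ} (hε : 0 < ε) :
    ∃ f : UnitAddCircle → ℝ, ContDiff ℝ ∞ (fun x : ℝ => f (x : UnitAddCircle)) ∧
      (∀ x y, |f x - f y| ≤ dist x y) ∧ ∀ x, |f x - g x| ≤ ε := by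
  let φ : ContDiffBump (0 : ℝ) := ⟨ε / 2, ε, by linarith, by linarith⟩
  have hgc : Continuous g := by
    refine (LipschitzWith.of_dist_le_mul (K := 1) fun x y => ?_).continuous
    simpa [Real.dist_eq] using hg x y
  have hφc : Continuous (φ.normed volume) := φ.continuous_normed
  have hφ1 : ∫ t, φ.normed volume t = 1 := φ.integral_normed
  have hφi : Integrable (φ.normed volume) := φ.integrable_normed
  have hint : ∀ y : UnitAddCircle,
      Integrable fun t : ℝ => φ.normed volume t * g (y - (t : UnitAddCircle)) := fun y =>
    (hφc.mul (hgc.comp (continuous_const.sub (AddCircle.continuous_mk' 1))))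
      |>.integrable_of_hasCompactSupport φ.hasCompactSupport_normed.mul_right
  refine ⟨fun y => ∫ t : ℝ, φ.normed volume t * g (y - (t : UnitAddCircle)), ?_, ?_, ?_⟩
  · exact φ.hasCompactSupport_normed.contDiff_convolution_left (𝕜 := ℝ) (n := ⊤)
      (g := fun x : ℝ => g (x : UnitAddCircle)) (ContinuousLinearMap.mul ℝ ℝ) φ.contDiff_normed
      (hgc.comp (AddCircle.continuous_mk' 1)).locallyIntegrable
  · intro x y
    rw [← integral_sub (hint x) (hint y), ← Real.norm_eq_abs]
    calc _ ≤ ∫ t : ℝ, φ.normed volume t * dist x y := by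
          refine norm_integral_le_of_norm_le (hφi.mul_const _) (.of_forall fun t => ?_)
          rw [← mul_sub, norm_mul, Real.norm_of_nonneg (φ.nonneg_normed t), Real.norm_eq_abs]
          refine mul_le_mul_of_nonneg_left ((hg _ _).trans_eq ?_) (φ.nonneg_normed t)
          rw [dist_sub_right]
      _ = dist x y := by rw [integral_mul_const, hφ1, one_mul]
  · intro x
    have hx : g x = ∫ t : ℝ, φ.normed volume t * g x := by
      rw [integral_mul_const, hφ1, one_mul]
    rw [hx, ← integral_sub (hint x) (hφi.mul_const _), ← Real.norm_eq_abs]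
    calc _ ≤ ∫ t : ℝ, φ.normed volume t * ε := by
          refine norm_integral_le_of_norm_le (hφi.mul_const _) (.of_forall fun t => ?_)
          rw [← mul_sub, norm_mul, Real.norm_of_nonneg (φ.nonneg_normed t), Real.norm_eq_abs]
          by_cases ht : t ∈ Metric.ball (0 : ℝ) ε
          · refine mul_le_mul_of_nonneg_left ((hg _ _).trans ?_) (φ.nonneg_normed t)
            rw [dist_eq_norm, sub_sub_cancel_left, norm_neg]
            refine (QuotientAddGroup.norm_mk_le_norm
              (S := AddSubgroup.zmultiples (1 : ℝ)) (m := t)).trans ?_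
            exact (mem_ball_zero_iff.1 ht).le
          · have : φ.normed volume t = 0 := by
              rw [← Function.notMem_support, φ.support_normed_eq]
              exact ht
            simp [this]
      _ = ε := by rw [integral_mul_const, hφ1, one_mul]

/-! ## Lower bound for the energy on the circle -/

theorem continuous_of_smooth_lift {f : UnitAddCircle → ℝ}
    (hf : ContDiff ℝ ∞ fun x : ℝ => f (x : UnitAddCircle)) : Continuous f :=
  (QuotientAddGroup.isQuotientMap_mk (AddSubgroup.zmultiples (1 : ℝ))).continuous_iff.2
    hf.continuous

theorem isTestFunction_mul {T : ℝ} {η : ℝ → ℝ} {f : UnitAddCircle → ℝ} (hη : ContDiff ℝ ∞ η)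
    (hηc : HasCompactSupport η) (hηT : tsupport η ⊆ Ioo (-T) T)
    (hf : ContDiff ℝ ∞ fun x : ℝ => f (x : UnitAddCircle)) :
    IsTestFunction T fun t x => η t * f x where
  smooth := (hη.comp contDiff_fst).mul (hf.comp contDiff_snd)
  compactSupport := ⟨tsupport η, hηT, hηc, fun t ht x => by
    rw [image_eq_zero_of_notMem_tsupport ht, zero_mul]⟩

/-- The derivative of a function on the circle. -/
def circleDeriv (f : UnitAddCircle → ℝ) (y : UnitAddCircle) : ℝ :=
  deriv (fun k : ℝ => f (y + (k : UnitAddCircle))) 0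

theorem measurable_circleDeriv (f : UnitAddCircle → ℝ) : Measurable (circleDeriv f) := by
  have h : ∀ y, circleDeriv f y = deriv (fun x : ℝ => f (x : UnitAddCircle)) (circleRep y) := by
    intro y
    have := deriv_comp_const_add (f := fun x : ℝ => f (x : UnitAddCircle)) (circleRep y) 0
    rw [add_zero] at this
    rw [← this, circleDeriv]
    simp only [AddCircle.coe_add, coe_circleRep]
  rw [show circleDeriv f = _ from funext h]
  exact (measurable_deriv _).comp measurable_circleRep

theorem norm_circleDeriv_le {f : UnitAddCircle → ℝ} {L : ℝ} (hL : 0 ≤ L)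
    (hf : ∀ x y, |f x - f y| ≤ L * dist x y) (y : UnitAddCircle) : ‖circleDeriv f y‖ ≤ L := by
  refine norm_deriv_le_of_lipschitz (C := ⟨L, hL⟩) (LipschitzWith.of_dist_le_mul fun s t => ?_)
  rw [Real.dist_eq]
  refine (hf _ _).trans (mul_le_mul_of_nonneg_left ?_ hL)
  rw [dist_add_left, dist_eq_norm, ← AddCircle.coe_sub, dist_eq_norm]
  exact QuotientAddGroup.norm_mk_le_norm (S := AddSubgroup.zmultiples (1 : ℝ))

theorem integrable_of_continuous_circle {f : UnitAddCircle → ℝ} (hf : Continuous f)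
    (ν : Measure UnitAddCircle) [IsFiniteMeasure ν] : Integrable f ν :=
  hf.integrable_of_hasCompactSupport (HasCompactSupport.of_compactSpace f)

/-- Left neighbourhoods have positive measure, so limits up to null sets of times are unique; this
is what identifies the trace. -/
theorem neBot_nhdsLT_inf_ae (T : ℝ) : (𝓝[<] T ⊓ ae (volume : Measure ℝ)).NeBot := by
  rw [inf_neBot_iff]
  intro s hs s' hs'
  obtain ⟨a, ha, has⟩ := (mem_nhdsLT_iff_exists_Ioo_subset).1 hs
  by_contra hne
  have hsub : Ioo a T ⊆ s'ᶜ := fun t ht ht' => hne ⟨t, has ht, ht'⟩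
  have h0 : volume (Ioo a T) = 0 := measure_mono_null hsub hs'
  rw [Real.volume_Ioo, ENNReal.ofReal_eq_zero] at h0
  linarith [mem_Iio.1 ha]

/-! ### Time regularity of admissible pairs -/

section Admissible

variable {T : ℝ} {μ : Kernel ℝ UnitAddCircle} {v : ℝ × UnitAddCircle → ℝ}

/-- Along an admissible pair the integral of a smooth function is a.e. equal to a primitive of the
integral of its derivative against the momentum. -/
theorem IsAdmissiblePair.exists_ae_eq (h : IsAdmissiblePair T μ v) (hT : 0 < T)
    {f : UnitAddCircle → ℝ} (hf : ContDiff ℝ ∞ fun x : ℝ => f (x : UnitAddCircle)) {L : ℝ}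
    (hL : 0 ≤ L) (hfL : ∀ x y, |f x - f y| ≤ L * dist x y) :
    IntegrableOn (fun t => ∫ y, v (t, y) * circleDeriv f y ∂μ t) (Ioo (-T) T) ∧
    ∃ c, ∀ᵐ t, t ∈ Ioo (-T) T → ∫ y, f y ∂μ t
      = c + ∫ s in (-T)..t, ∫ y, v (s, y) * circleDeriv f y ∂μ s := by
  have := h.finite
  have hfc := continuous_of_smooth_lift hf
  have hfin : IsFiniteMeasure (spaceTimeMeasure T μ) := by
    unfold spaceTimeMeasure; infer_instance
  obtain ⟨C, hC⟩ := isCompact_univ.exists_bound_of_continuousOn hfc.continuousOn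
  have hfi : Integrable (fun p : ℝ × UnitAddCircle => f p.2) (spaceTimeMeasure T μ) :=
    Integrable.of_bound (hfc.measurable.comp measurable_snd).aestronglyMeasurable C
      (.of_forall fun p => hC p.2 (mem_univ _))
  have hvi : Integrable (fun p : ℝ × UnitAddCircle => v p * circleDeriv f p.2)
      (spaceTimeMeasure T μ) :=
    Integrable.mul_bdd (c := L) h.integrable
      ((measurable_circleDeriv f).comp measurable_snd).aestronglyMeasurable
      (.of_forall fun p => norm_circleDeriv_le hL hfL p.2)
  have hi1 : IntegrableOn (fun t => ∫ y, f y ∂μ t) (Ioo (-T) T) :=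
    Integrable.integral_compProd (κ := Kernel.const Unit (volume.restrict (Ioo (-T) T)))
      (η := Kernel.prodMkLeft Unit μ) (a := ()) hfi
  have hi2 : IntegrableOn (fun t => ∫ y, v (t, y) * circleDeriv f y ∂μ t) (Ioo (-T) T) :=
    Integrable.integral_compProd (κ := Kernel.const Unit (volume.restrict (Ioo (-T) T)))
      (η := Kernel.prodMkLeft Unit μ) (a := ()) hvi
  refine ⟨hi2, ae_eq_add_integral_of_weak_deriv (by linarith) hi1 hi2 fun η hη hηc hηT => ?_⟩
  -- Testing with products `η t * f x` reads the continuity equation as a weak derivative in time.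
  have hz := h.continuityEq _ (isTestFunction_mul hη hηc hηT hf)
  have hcongr : ∀ p : ℝ × UnitAddCircle, deriv (fun s => η s * f p.2) p.1
      + v p * deriv (fun k : ℝ => η p.1 * f (p.2 + (k : UnitAddCircle))) 0
      = deriv η p.1 * f p.2 + η p.1 * (v p * circleDeriv f p.2) := by
    intro p
    rw [deriv_mul_const_field, deriv_const_mul_field, circleDeriv]
    ring
  simp only [hcongr] at hz
  obtain ⟨C₁, hC₁⟩ := hηc.exists_bound_of_continuous hη.continuous
  obtain ⟨C₂, hC₂⟩ := hηc.deriv.exists_bound_of_continuous (hη.continuous_deriv (by simp))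
  have j1 : Integrable (fun p : ℝ × UnitAddCircle => deriv η p.1 * f p.2)
      (spaceTimeMeasure T μ) :=
    Integrable.bdd_mul (c := C₂) hfi ((measurable_deriv η).comp measurable_fst).aestronglyMeasurable
      (.of_forall fun p => hC₂ p.1)
  have j2 : Integrable (fun p : ℝ × UnitAddCircle => η p.1 * (v p * circleDeriv f p.2))
      (spaceTimeMeasure T μ) :=
    Integrable.bdd_mul (c := C₁) hvi
      (hη.continuous.measurable.comp measurable_fst).aestronglyMeasurable
      (.of_forall fun p => hC₁ p.1)
  rw [integral_add j1 j2, spaceTimeMeasure, Measure.integral_compProd j1,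
    Measure.integral_compProd j2] at hz
  simp only [integral_const_mul] at hz
  rw [integral_add _ _, hz]
  · exact integrableOn_mul_of_hasCompactSupport (hη.continuous_deriv (by simp)) hηc.deriv hi1
  · exact integrableOn_mul_of_hasCompactSupport hη.continuous hηc hi2

/-- The integral of `f` against `μ_t` agrees a.e. with a primitive, whose limit at `T` must be the
integral against the trace. The difference is then a time integral of `f'` against the momentum, and
`|f'| ≤ L`. -/
theorem IsAdmissiblePair.ae_enorm_integral_sub_le (h : IsAdmissiblePair T μ v) (hT : 0 < T)
    {ν : Measure UnitAddCircle} (hν : IsTraceAlong (𝓝[<] T ⊓ ae volume) μ ν)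
    {f : UnitAddCircle → ℝ} (hf : ContDiff ℝ ∞ fun x : ℝ => f (x : UnitAddCircle)) {L : ℝ}
    (hL : 0 ≤ L) (hfL : ∀ x y, |f x - f y| ≤ L * dist x y) :
    ∀ᵐ t, t ∈ Ioo (-T) T → ‖(∫ y, f y ∂ν) - ∫ y, f y ∂μ t‖ₑ
      ≤ ENNReal.ofReal L * ∫⁻ p, ‖v p‖ₑ ∂(spaceTimeMeasure T μ) := by
  have := h.finite
  obtain ⟨hi, c, hc⟩ := h.exists_ae_eq hT hf hL hfL
  set w : ℝ → ℝ := fun t => ∫ y, v (t, y) * circleDeriv f y ∂μ t with hw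
  have hTT : -T ≤ T := by linarith
  have hwi : IntervalIntegrable w volume (-T) T := by
    rwa [intervalIntegrable_iff_integrableOn_Ioo_of_le hTT]
  have hcont := (hwi.absolutelyContinuousOnInterval_intervalIntegral left_mem_uIcc).continuousOn
  have htend : Tendsto (fun t => c + ∫ s in (-T)..t, w s) (𝓝[<] T ⊓ ae volume)
      (𝓝 (c + ∫ s in (-T)..T, w s)) := by
    refine Tendsto.const_add c (Tendsto.mono_left ?_ inf_le_left)
    have h1 := hcont T right_mem_uIcc
    refine Tendsto.mono_left h1 (nhdsWithin_le_iff.2 ?_)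
    rw [uIcc_of_le hTT]
    filter_upwards [Ioo_mem_nhdsLT (show -T < T by linarith)] with t ht
      using Ioo_subset_Icc_self ht
  have hlim : ∫ y, f y ∂ν = c + ∫ s in (-T)..T, w s := by
    have := neBot_nhdsLT_inf_ae T
    refine tendsto_nhds_unique (hν.2 ⟨f, continuous_of_smooth_lift hf⟩) (htend.congr' ?_)
    have h1 : ∀ᶠ t in 𝓝[<] T ⊓ ae volume, t ∈ Ioo (-T) T :=
      mem_inf_of_left (Ioo_mem_nhdsLT (show -T < T by linarith))
    have h2 : ∀ᶠ t in 𝓝[<] T ⊓ ae volume, t ∈ Ioo (-T) T → ∫ y, f y ∂μ t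
      = c + ∫ s in (-T)..t, w s := mem_inf_of_right hc
    filter_upwards [h1, h2] with t ht ht' using (ht' ht).symm
  filter_upwards [hc] with t ht htm
  have hsub : IntervalIntegrable w volume (-T) t :=
    hwi.mono_set (by
      rw [uIcc_of_le hTT, uIcc_of_le htm.1.le]
      exact Icc_subset_Icc_right htm.2.le)
  rw [hlim, ht htm, add_sub_add_left_eq_sub, intervalIntegral.integral_interval_sub_left hwi hsub,
    intervalIntegral.integral_of_le htm.2.le, integral_Ioc_eq_integral_Ioo]
  have hvm : AEMeasurable (fun p => ‖v p‖ₑ) (spaceTimeMeasure T μ) := h.integrable.1.enorm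
  calc ‖∫ s in Ioo t T, w s‖ₑ
      ≤ ∫⁻ s in Ioo t T, ‖w s‖ₑ := enorm_integral_le_lintegral_enorm _
    _ ≤ ∫⁻ s in Ioo (-T) T, ‖w s‖ₑ := lintegral_mono_set (Ioo_subset_Ioo_left htm.1.le)
    _ ≤ ∫⁻ s in Ioo (-T) T, ∫⁻ y, ENNReal.ofReal L * ‖v (s, y)‖ₑ ∂μ s := by
        refine lintegral_mono fun s => (enorm_integral_le_lintegral_enorm _).trans
          (lintegral_mono fun y => ?_)
        rw [enorm_mul, mul_comm]
        gcongr
        rw [← ofReal_norm]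
        exact ENNReal.ofReal_le_ofReal (norm_circleDeriv_le hL hfL y)
    _ = ENNReal.ofReal L * ∫⁻ s in Ioo (-T) T, ∫⁻ y, ‖v (s, y)‖ₑ ∂μ s := by
        simp only [lintegral_const_mul' _ _ ENNReal.ofReal_ne_top]
    _ = _ := by
        rw [spaceTimeMeasure] at hvm
        have := Kernel.lintegral_compProd₀ (Kernel.const Unit (volume.restrict (Ioo (-T) T)))
          (Kernel.prodMkLeft Unit μ) (a := ()) hvm
        rw [spaceTimeMeasure]
        congr 1
        exact this.symm

/-- A constant test function has Lipschitz constant `0`, so the previous estimate becomes an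
equality of masses. -/
theorem IsAdmissiblePair.ae_measure_univ (h : IsAdmissiblePair T μ v) (hT : 0 < T)
    {ν : Measure UnitAddCircle} (hν : IsTraceAlong (𝓝[<] T ⊓ ae volume) μ ν) :
    ∀ᵐ t, t ∈ Ioo (-T) T → μ t univ = ν univ := by
  have := h.finite
  have := hν.1
  filter_upwards [h.ae_enorm_integral_sub_le hT hν (f := fun _ => 1) contDiff_const le_rfl
    (fun x y => by simp)] with t ht htm
  have h0 := ht htm
  rw [ENNReal.ofReal_zero, zero_mul, nonpos_iff_eq_zero, enorm_eq_zero, sub_eq_zero] at h0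
  simp only [integral_const, smul_eq_mul, mul_one] at h0
  exact ((measureReal_eq_measureReal_iff).1 h0).symm

/-- Cauchy-Schwarz for the momentum of a pair with mass one. -/
theorem IsAdmissiblePair.sq_lintegral_enorm_le (h : IsAdmissiblePair T μ v)
    (hmass : ∀ᵐ t, t ∈ Ioo (-T) T → μ t univ = 1) :
    (∫⁻ p, ‖v p‖ₑ ∂(spaceTimeMeasure T μ)) ^ 2
      ≤ ENNReal.ofReal (2 * T) * ∫⁻ p, ‖v p‖ₑ ^ 2 ∂(spaceTimeMeasure T μ) := by
  have := h.finite
  refine (sq_lintegral_le h.integrable.1.enorm).trans_eq ?_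
  congr 1
  rw [spaceTimeMeasure, Measure.compProd_apply MeasurableSet.univ]
  simp only [preimage_univ]
  rw [setLIntegral_congr_fun_ae measurableSet_Ioo hmass, setLIntegral_const, Real.volume_Ioo,
    one_mul]
  congr 1
  ring

end Admissible

instance isProbabilityMeasure_unitAddCircle : IsProbabilityMeasure (volume : Measure UnitAddCircle) :=
  ⟨UnitAddCircle.measure_univ⟩

/-- The easy half of Kantorovich duality. -/
theorem enorm_integral_sub_sq_le {ν : Measure UnitAddCircle} [IsFiniteMeasure ν]
    {π : Measure (UnitAddCircle × UnitAddCircle)} (hπ : π.fst = ν ∧ π.snd = volume)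
    {f : UnitAddCircle → ℝ} (hf : Continuous f) (hfL : ∀ x y, |f x - f y| ≤ dist x y) :
    ‖(∫ y, f y ∂ν) - ∫ y, f y‖ₑ ^ 2 ≤ ∫⁻ p, edist p.1 p.2 ^ 2 ∂π := by
  have hπ1 : π univ = 1 := by rw [← Measure.snd_univ, hπ.2, measure_univ]
  have i1 : Integrable (fun p : UnitAddCircle × UnitAddCircle => f p.1) π := by
    have : Integrable f (π.map Prod.fst) := by
      change Integrable f π.fst
      rw [hπ.1]
      exact integrable_of_continuous_circle hf ν
    exact this.comp_measurable measurable_fst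
  have i2 : Integrable (fun p : UnitAddCircle × UnitAddCircle => f p.2) π := by
    have : Integrable f (π.map Prod.snd) := by
      change Integrable f π.snd
      rw [hπ.2]
      exact integrable_of_continuous_circle hf volume
    exact this.comp_measurable measurable_snd
  have e1 : ∫ y, f y ∂ν = ∫ p, f p.1 ∂π := by
    rw [← hπ.1]
    exact integral_map measurable_fst.aemeasurable hf.aestronglyMeasurable
  have e2 : ∫ y, f y = ∫ p, f p.2 ∂π := by
    rw [← hπ.2]
    exact integral_map measurable_snd.aemeasurable hf.aestronglyMeasurable
  rw [e1, e2, ← integral_sub i1 i2]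
  calc _ ≤ (∫⁻ p, edist p.1 p.2 ∂π) ^ 2 := by
        refine pow_le_pow_left₀ zero_le ((enorm_integral_le_lintegral_enorm _).trans
          (lintegral_mono fun p => ?_)) 2
        rw [edist_dist, ← ofReal_norm, Real.norm_eq_abs]
        exact ENNReal.ofReal_le_ofReal (hfL _ _)
    _ ≤ π univ * ∫⁻ p, edist p.1 p.2 ^ 2 ∂π := sq_lintegral_le (by fun_prop)
    _ = _ := by rw [hπ1, one_mul]

/-- On average, the distance to at most `n` points of the circle is at least `1 / (8 n)`. -/
theorem le_integral_infDist {n : ℕ} (hn : 0 < n) {ι : Type*} (J : Finset ι) (hJ : J.card ≤ n)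
    (q : ι → UnitAddCircle) (hJne : J.Nonempty) :
    1 / (8 * n : ℝ) ≤ ∫ y : UnitAddCircle, Metric.infDist y (q '' J) := by
  have hn' : (0 : ℝ) < n := Nat.cast_pos.2 hn
  -- With radius `1 / (4 n)` the balls cover at most half of the circle, and off them the distance
  -- is at least `1 / (4 n)`.
  set B : Set UnitAddCircle := ⋃ j ∈ J, Metric.closedBall (q j) (1 / (4 * n)) with hB
  have hBm : MeasurableSet B :=
    Finset.measurableSet_biUnion J fun j _ => Metric.isClosed_closedBall.measurableSet
  have hvol : volume B ≤ ENNReal.ofReal (1 / 2) := by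
    calc volume B ≤ ∑ j ∈ J, volume (Metric.closedBall (q j) (1 / (4 * n : ℝ))) :=
          measure_biUnion_finset_le _ _
      _ ≤ ∑ j ∈ J, ENNReal.ofReal (1 / (2 * n)) := by
          refine Finset.sum_le_sum fun j _ => ?_
          rw [AddCircle.volume_closedBall]
          refine ENNReal.ofReal_le_ofReal ((min_le_right _ _).trans_eq ?_)
          field_simp
          norm_num
      _ = J.card * ENNReal.ofReal (1 / (2 * n)) := by rw [Finset.sum_const, nsmul_eq_mul]
      _ ≤ n * ENNReal.ofReal (1 / (2 * n)) := by gcongr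
      _ = _ := by
          rw [← ENNReal.ofReal_natCast, ← ENNReal.ofReal_mul hn'.le]
          congr 1
          field_simp
  have hBr : volume.real B ≤ 1 / 2 := ENNReal.toReal_le_of_le_ofReal (by norm_num) hvol
  have hBc : 1 / 2 ≤ volume.real Bᶜ := by
    rw [probReal_compl_eq_one_sub hBm]
    linarith
  have hint : Integrable (fun y : UnitAddCircle => Metric.infDist y (q '' J)) :=
    integrable_of_continuous_circle (Metric.continuous_infDist_pt _) volume
  calc 1 / (8 * n : ℝ) = 1 / 2 * (1 / (4 * n)) := by field_simp; norm_num
    _ ≤ volume.real Bᶜ * (1 / (4 * n)) := by gcongr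
    _ = ∫ y in Bᶜ, 1 / (4 * n : ℝ) := by rw [setIntegral_const, smul_eq_mul]
    _ ≤ ∫ y in Bᶜ, Metric.infDist y (q '' J) := by
        refine setIntegral_mono_on (integrable_const _) hint.integrableOn hBm.compl fun y hy => ?_
        refine (Metric.le_infDist ((Finset.coe_nonempty.2 hJne).image q)).2 ?_
        rintro _ ⟨j, hj, rfl⟩
        by_contra hlt
        exact hy (mem_biUnion hj (not_le.1 hlt).le)
    _ ≤ _ := setIntegral_le_integral hint (.of_forall fun y => Metric.infDist_nonneg)

/-- If a measure with `n` atoms can be compared with a measure `ν`, then `ν` is not too close to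
the Lebesgue measure. -/
theorem le_of_atomic {m ν : Measure UnitAddCircle} [IsProbabilityMeasure m] {n : ℕ}
    (hatoms : {x | m {x} ≠ 0}.encard = n) (hS : ∃ S : Set UnitAddCircle, S.Countable ∧ m Sᶜ = 0)
    {F : Finset ℕ → ℕ → UnitAddCircle → ℝ} (hFc : ∀ J k, Continuous (F J k))
    (hF : ∀ (J : Finset ℕ) (k : ℕ) (x : UnitAddCircle),
      |F J k x - Metric.infDist x (TopologicalSpace.denseSeq UnitAddCircle '' J)| ≤ 1 / (k + 1 : ℝ))
    {a b : ℝ} (ha : ∀ J k, |(∫ y, F J k y ∂ν) - ∫ y, F J k y ∂m| ≤ a)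
    (hb : ∀ J k, |(∫ y, F J k y ∂ν) - ∫ y, F J k y| ≤ b) :
    0 < n ∧ 1 / (8 * n : ℝ) ≤ a + b := by
  obtain ⟨S, hSc, hS0⟩ := hS
  set A : Set UnitAddCircle := {x | m {x} ≠ 0} with hA
  have hAfin : A.Finite := finite_of_encard_eq_coe hatoms
  have hAc : m Aᶜ = 0 := by
    have hsub : Aᶜ ⊆ Sᶜ ∪ (S \ A) := fun x hx => by
      by_cases h : x ∈ S
      · exact Or.inr ⟨h, hx⟩
      · exact Or.inl h
    refine measure_mono_null hsub (measure_union_null hS0 ?_)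
    rw [← biUnion_of_singleton (S \ A), measure_biUnion_null_iff (hSc.mono sdiff_subset)]
    intro x hx
    by_contra h
    exact hx.2 h
  have hAne : A.Nonempty := by
    by_contra h
    rw [not_nonempty_iff_eq_empty] at h
    rw [h, compl_empty, measure_univ] at hAc
    exact one_ne_zero hAc
  have hn : 0 < n := by
    rcases Nat.eq_zero_or_pos n with h | h
    · rw [h, Nat.cast_zero, encard_eq_zero] at hatoms
      exact absurd hatoms hAne.ne_empty
    · exact h
  refine ⟨hn, ?_⟩
  -- Of the error `3 ε`, one `ε` pays for moving the atoms to the dense sequence, and one for each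
  -- of the two replacements of the distance by its smoothing, against `m` and against Lebesgue
  -- measure.
  have hkey : ∀ k : ℕ, 1 / (8 * n : ℝ) ≤ a + b + 3 * (1 / (k + 1 : ℝ)) := by
    intro k
    set ε : ℝ := 1 / (k + 1 : ℝ) with hε
    have hε0 : 0 < ε := by positivity
    have hdense : ∀ x : UnitAddCircle,
        ∃ j, dist x (TopologicalSpace.denseSeq UnitAddCircle j) < ε := fun x =>
      (TopologicalSpace.denseRange_denseSeq UnitAddCircle).exists_dist_lt x hε0
    choose j hj using hdense
    classical
    set J : Finset ℕ := hAfin.toFinset.image j with hJ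
    have hJcard : J.card ≤ n := by
      refine Finset.card_image_le.trans ?_
      rw [hAfin.encard_eq_coe_toFinset_card] at hatoms
      exact_mod_cast hatoms.le
    have hJne : J.Nonempty := by
      rw [hJ, Finset.image_nonempty, hAfin.toFinset_nonempty]
      exact hAne
    have h1 : ∫ y, F J k y ∂m ≤ 2 * ε := by
      have hae : ∀ᵐ y ∂m, F J k y ≤ 2 * ε := by
        have : ∀ᵐ y ∂m, y ∈ A := hAc
        filter_upwards [this] with y hy
        have e1 := (abs_le.1 (hF J k y)).2
        have e2 : Metric.infDist y (TopologicalSpace.denseSeq UnitAddCircle '' J) ≤ ε := by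
          have hjy : j y ∈ (J : Set ℕ) :=
            Finset.mem_coe.2 (Finset.mem_image_of_mem j (hAfin.mem_toFinset.2 hy))
          exact (Metric.infDist_le_dist_of_mem (mem_image_of_mem _ hjy)).trans (hj y).le
        linarith
      refine (integral_mono_ae (integrable_of_continuous_circle (hFc J k) m)
        (integrable_const _) hae).trans_eq ?_
      simp
    have h2 : 1 / (8 * n : ℝ) - ε ≤ ∫ y, F J k y := by
      calc 1 / (8 * n : ℝ) - ε
          ≤ (∫ y : UnitAddCircle, Metric.infDist y (TopologicalSpace.denseSeq UnitAddCircle '' J))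
              - ε := by
            gcongr
            exact le_integral_infDist hn J hJcard _ hJne
        _ = ∫ y : UnitAddCircle,
              (Metric.infDist y (TopologicalSpace.denseSeq UnitAddCircle '' J) - ε) := by
            rw [integral_sub (integrable_of_continuous_circle (Metric.continuous_infDist_pt _) _)
              (integrable_const _)]
            simp
        _ ≤ _ := by
            refine integral_mono
              ((integrable_of_continuous_circle (Metric.continuous_infDist_pt _) _).sub
                (integrable_const _)) (integrable_of_continuous_circle (hFc J k) _) fun y => ?_
            have := (abs_le.1 (hF J k y)).1
            simp only
            linarith
    have h3 := (abs_le.1 (ha J k)).2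
    have h4 := (abs_le.1 (hb J k)).1
    linarith
  have hlim : Tendsto (fun k : ℕ => a + b + 3 * (1 / (k + 1 : ℝ))) atTop (𝓝 (a + b + 3 * 0)) :=
    (tendsto_one_div_add_atTop_nhds_zero_nat.const_mul 3).const_add _
  rw [mul_zero, add_zero] at hlim
  exact ge_of_tendsto' hlim hkey

/-- The scaling law that follows from `T ≲ E (√(T E) + √(E / lam))`. -/
theorem scaling_lower_bound {T lam E : ℝ} (hT : 0 < T) (hl : 0 < lam) (hE : 2 * T ≤ E)
    (h : 2 * T * (1 / (8 * (√(2 * T * E) + √(E / lam)))) ≤ E) :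
    1 / 10 * (T + min (T ^ (1 / 3 : ℝ)) (lam ^ (1 / 3 : ℝ) * T ^ (2 / 3 : ℝ))) ≤ E := by
  have hE0 : 0 < E := by linarith
  set m := min (T ^ (1 / 3 : ℝ)) (lam ^ (1 / 3 : ℝ) * T ^ (2 / 3 : ℝ)) with hm
  have hm0 : 0 < m := by positivity
  have hm1 : m ^ 3 ≤ T := by
    calc m ^ 3 ≤ (T ^ (1 / 3 : ℝ)) ^ 3 := by gcongr; exact min_le_left _ _
      _ = T := by
        rw [← Real.rpow_natCast, ← Real.rpow_mul hT.le]
        norm_num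
  have hm2 : m ^ 3 ≤ lam * T ^ 2 := by
    calc m ^ 3 ≤ (lam ^ (1 / 3 : ℝ) * T ^ (2 / 3 : ℝ)) ^ 3 := by gcongr; exact min_le_right _ _
      _ = lam * T ^ 2 := by
        rw [mul_pow, ← Real.rpow_natCast, ← Real.rpow_mul hl.le, ← Real.rpow_natCast,
          ← Real.rpow_mul hT.le, ← Real.rpow_natCast T 2]
        norm_num
  -- The part in `T` is already controlled by `2 * T ≤ E`.
  suffices hmE : m ≤ 5 * E by linarith
  by_contra hlt
  rw [not_le] at hlt
  set r₁ := √(2 * T * E) with hr₁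
  set r₂ := √(E / lam) with hr₂
  have h1 : r₁ ^ 2 = 2 * T * E := Real.sq_sqrt (by positivity)
  have h2 : r₂ ^ 2 = E / lam := Real.sq_sqrt (by positivity)
  have hr1 : 0 < r₁ := Real.sqrt_pos.2 (by positivity)
  have hr2 : 0 < r₂ := Real.sqrt_pos.2 (by positivity)
  have hTR : T ≤ 4 * E * (r₁ + r₂) := by
    have : 2 * T * (1 / (8 * (r₁ + r₂))) = T / (4 * (r₁ + r₂)) := by
      field_simp
      norm_num
    rw [this, div_le_iff₀ (by positivity)] at h
    linarith
  have hsq : T ^ 2 ≤ 32 * E ^ 3 * (2 * T + 1 / lam) := by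
    calc T ^ 2 ≤ (4 * E * (r₁ + r₂)) ^ 2 := by gcongr
      _ ≤ 16 * E ^ 2 * (2 * (r₁ ^ 2 + r₂ ^ 2)) := by
        rw [mul_pow, mul_pow]
        norm_num
        gcongr
        nlinarith [sq_nonneg (r₁ - r₂)]
      _ = _ := by rw [h1, h2]; ring
  have hE3 : 125 * E ^ 3 < m ^ 3 := by
    calc 125 * E ^ 3 = (5 * E) ^ 3 := by ring
      _ < m ^ 3 := by gcongr
  -- If `5 E < m`, the two bounds on `m ^ 3` turn `hsq` into `T ^ 2 ≤ (96 / 125) * T ^ 2`, a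
  -- contradiction.
  have e1 : E ^ 3 * (2 * T) ≤ T / 125 * (2 * T) := by gcongr; linarith
  have e2 : E ^ 3 * (1 / lam) ≤ T ^ 2 / 125 := by
    rw [mul_one_div, div_le_iff₀ hl]
    linarith
  have : 0 < T ^ 2 := by positivity
  nlinarith

theorem abs_le_of_enorm_le {x : ℝ} {c : ℝ≥0∞} (hc : c ≠ ⊤) (h : ‖x‖ₑ ≤ c) : |x| ≤ c.toReal := by
  have := ENNReal.toReal_mono hc h
  rwa [toReal_enorm, Real.norm_eq_abs] at this

theorem IsAdmissiblePair.le_pairEnergy_add {T lam : ℝ} (hT : 0 < T) (hl : 0 < lam)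
    {μ : Kernel ℝ UnitAddCircle} {v : ℝ × UnitAddCircle → ℝ} (h : IsAdmissiblePair T μ v)
    {ν : Measure UnitAddCircle} (hν : IsTraceAlong (𝓝[<] T ⊓ ae volume) μ ν)
    {π : Measure (UnitAddCircle × UnitAddCircle)} (hπ : π.fst = ν ∧ π.snd = volume) :
    ENNReal.ofReal (1 / 10 * (T + min (T ^ (1 / 3 : ℝ)) (lam ^ (1 / 3 : ℝ) * T ^ (2 / 3 : ℝ))))
      ≤ pairEnergy T μ v + ENNReal.ofReal lam * ∫⁻ p, edist p.1 p.2 ^ 2 ∂π := by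
  have := h.finite
  have := hν.1
  set Etot := pairEnergy T μ v + ENNReal.ofReal lam * ∫⁻ p, edist p.1 p.2 ^ 2 ∂π with hEtot
  by_cases htop : Etot = ⊤
  · rw [htop]
    exact le_top
  set D := ∫⁻ p, ‖v p‖ₑ ^ 2 ∂(spaceTimeMeasure T μ) with hD
  set w := ∫⁻ p, edist p.1 p.2 ^ 2 ∂π with hw
  set N : ℝ → ℝ≥0∞ := fun t => (({x | μ t {x} ≠ 0}.encard : ℕ∞) : ℝ≥0∞) with hN
  have hlam : ENNReal.ofReal lam ≠ 0 := by simpa using hl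
  have hNE : ∫⁻ t in Ioo (-T) T, N t ≤ Etot := le_self_add.trans le_self_add
  have hDE : D ≤ Etot := le_add_self.trans le_self_add
  have hwE : ENNReal.ofReal lam * w ≤ Etot := le_add_self
  have hDtop : D ≠ ⊤ := ne_top_of_le_ne_top htop hDE
  have hwtop : w ≠ ⊤ := fun hw' => by
    rw [hw', ENNReal.mul_top hlam, top_le_iff] at hwE
    exact htop hwE
  -- A plan with Lebesgue second marginal has mass one, and the trace inherits this.
  have hν1 : ν univ = 1 := by
    rw [← hπ.1, Measure.fst_univ, ← Measure.snd_univ, hπ.2, measure_univ]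
  have hmass : ∀ᵐ t, t ∈ Ioo (-T) T → μ t univ = 1 := by
    filter_upwards [h.ae_measure_univ hT hν] with t ht htm
    rw [ht htm, hν1]
  set M := ∫⁻ p, ‖v p‖ₑ ∂(spaceTimeMeasure T μ) with hM
  have hM2 : M ^ 2 ≤ ENNReal.ofReal (2 * T) * D := h.sq_lintegral_enorm_le hmass
  have hMtop : M ≠ ⊤ := fun hM' => by
    rw [hM', ENNReal.top_pow two_ne_zero, top_le_iff] at hM2
    exact ENNReal.mul_ne_top ENNReal.ofReal_ne_top hDtop hM2
  set E := Etot.toReal with hE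
  have hME : M.toReal ≤ √(2 * T * E) := by
    refine Real.le_sqrt_of_sq_le ?_
    have h1 := ENNReal.toReal_mono (ENNReal.mul_ne_top ENNReal.ofReal_ne_top hDtop) hM2
    rw [ENNReal.toReal_pow, ENNReal.toReal_mul, ENNReal.toReal_ofReal (by positivity)] at h1
    refine h1.trans ?_
    gcongr
    exact ENNReal.toReal_mono htop hDE
  have hwE' : √w.toReal ≤ √(E / lam) := by
    refine Real.sqrt_le_sqrt ?_
    rw [le_div_iff₀ hl, mul_comm]
    have h1 := ENNReal.toReal_mono htop hwE
    rwa [ENNReal.toReal_mul, ENNReal.toReal_ofReal hl.le] at h1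
  have hg : ∀ (J : Finset ℕ) (x y : UnitAddCircle),
      |Metric.infDist x (TopologicalSpace.denseSeq UnitAddCircle '' J)
        - Metric.infDist y (TopologicalSpace.denseSeq UnitAddCircle '' J)| ≤ dist x y := fun J x y => by
    simpa [Real.dist_eq] using (Metric.lipschitz_infDist_pt
      (TopologicalSpace.denseSeq UnitAddCircle '' (J : Set ℕ))).dist_le_mul x y
  have hex := fun (J : Finset ℕ) (k : ℕ) =>
    exists_smooth_near_of_lipschitz (hg J) (Nat.one_div_pos_of_nat (α := ℝ) (n := k))
  choose F hFs hFL hFg using hex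
  have hFc : ∀ J k, Continuous (F J k) := fun J k => continuous_of_smooth_lift (hFs J k)
  -- The family is countable, so one null set of times serves all its members; the member adapted to
  -- the atoms of `μ t` can be chosen afterwards.
  have hclose : ∀ᵐ t, ∀ J k, t ∈ Ioo (-T) T →
      |(∫ y, F J k y ∂ν) - ∫ y, F J k y ∂μ t| ≤ M.toReal := by
    rw [ae_all_iff]
    intro J
    rw [ae_all_iff]
    intro k
    filter_upwards [h.ae_enorm_integral_sub_le hT hν (hFs J k) zero_le_one
      (fun x y => by rw [one_mul]; exact hFL J k x y)] with t ht htm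
    have := ht htm
    rw [ENNReal.ofReal_one, one_mul] at this
    exact abs_le_of_enorm_le hMtop this
  have hfar : ∀ J k, |(∫ y, F J k y ∂ν) - ∫ y, F J k y| ≤ √w.toReal := by
    intro J k
    have h1 := ENNReal.toReal_mono hwtop (enorm_integral_sub_sq_le hπ (hFc J k) (hFL J k))
    rw [ENNReal.toReal_pow, toReal_enorm, Real.norm_eq_abs] at h1
    exact Real.le_sqrt_of_sq_le h1
  set R := √(2 * T * E) + √(E / lam) with hR
  have hcount : ∀ᵐ t, t ∈ Ioo (-T) T → 1 ≤ N t ∧ ENNReal.ofReal (1 / (8 * R)) ≤ N t := by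
    filter_upwards [hmass, hclose, (ae_restrict_iff' measurableSet_Ioo).1 h.atomic]
      with t ht1 ht2 ht3 htm
    -- Infinitely many atoms make the count infinite, and both bounds are then trivial.
    rcases eq_or_ne {x | μ t {x} ≠ 0}.encard ⊤ with hc | hc
    · simp [hN, hc]
    · obtain ⟨n, hn⟩ := ENat.ne_top_iff_exists.1 hc
      have : IsProbabilityMeasure (μ t) := ⟨ht1 htm⟩
      obtain ⟨hn0, hn1⟩ := le_of_atomic hn.symm (ht3 htm) hFc hFg (fun J k => ht2 J k htm) hfar
      have hNt : N t = n := by simp only [hN, ← hn, ENat.toENNReal_coe]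
      have hn' : (0 : ℝ) < n := Nat.cast_pos.2 hn0
      rw [hNt]
      refine ⟨by exact_mod_cast hn0, ?_⟩
      rw [← ENNReal.ofReal_natCast]
      refine ENNReal.ofReal_le_ofReal ?_
      have hnR : 1 / (8 * n : ℝ) ≤ R := hn1.trans (add_le_add hME hwE')
      have hR0 : 0 < R := lt_of_lt_of_le (by positivity) hnR
      rw [div_le_iff₀ (by positivity)] at hnR ⊢
      linarith
  have hlower : ∀ c : ℝ, 0 ≤ c → (∀ᵐ t, t ∈ Ioo (-T) T → ENNReal.ofReal c ≤ N t) →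
      2 * T * c ≤ E := by
    intro c hc hcN
    refine (ENNReal.ofReal_le_iff_le_toReal htop).1 (le_trans ?_ hNE)
    calc ENNReal.ofReal (2 * T * c) = ∫⁻ t in Ioo (-T) T, ENNReal.ofReal c := by
          rw [setLIntegral_const, Real.volume_Ioo, ← ENNReal.ofReal_mul hc]
          congr 1
          ring
      _ ≤ _ := lintegral_mono_ae ((ae_restrict_iff' measurableSet_Ioo).2 hcN)
  have hE1 := hlower 1 zero_le_one (by
    filter_upwards [hcount] with t ht htm
    rw [ENNReal.ofReal_one]
    exact (ht htm).1)
  have hE2 := hlower (1 / (8 * R)) (by positivity) (by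
    filter_upwards [hcount] with t ht htm using (ht htm).2)
  rw [mul_one] at hE1
  exact ENNReal.ofReal_le_of_le_toReal (scaling_lower_bound hT hl hE1 hE2)

theorem le_minEnergy1d {T lam : ℝ} (hT : 0 < T) (hl : 0 < lam) :
    ENNReal.ofReal (1 / 10 * (T + min (T ^ (1 / 3 : ℝ)) (lam ^ (1 / 3 : ℝ) * T ^ (2 / 3 : ℝ))))
      ≤ minEnergy1d lam T := by
  refine le_iInf₂ fun μ _ => ?_
  have hlam : ENNReal.ofReal lam ≠ 0 := by simpa using hl
  -- The trace at `T` alone suffices; the penalty at `-T` is dropped. Pulling the infima outside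
  -- reduces the claim to a fixed velocity, trace and transport plan.
  calc _ ≤ internalEnergy T μ + ENNReal.ofReal lam * boundaryCost (𝓝[<] T ⊓ ae volume) μ := by
        simp only [internalEnergy, boundaryCost, wassersteinPerSq, ENNReal.iInf_add,
          ENNReal.mul_iInf_of_ne hlam ENNReal.ofReal_ne_top, ENNReal.add_iInf]
        simp only [le_iInf_iff]
        intros
        exact IsAdmissiblePair.le_pairEnergy_add hT hl ‹_› ‹_› ‹_›
    _ ≤ _ := by
        unfold energy1d
        gcongr
        exact le_self_add

end

theorem proposition4p8 :
    (∃ c C : ℝ, 0 < c ∧ 0 < C ∧ ∀ Φ T lam : ℝ, 0 < Φ → 0 < T → 0 < lam →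
      ENNReal.ofReal (c * (T + lam * Φ ^ 3 / (1 + lam * T))) ≤ irrigationCost Φ T lam ∧
      irrigationCost Φ T lam ≤ ENNReal.ofReal (C * (T + lam * Φ ^ 3 / (1 + lam * T)))) ∧
    (∃ c C : ℝ, 0 < c ∧ 0 < C ∧ ∀ T lam : ℝ, 0 < T → 0 < lam →
      ENNReal.ofReal (c * (T + min (T ^ (1 / 3 : ℝ)) (lam ^ (1 / 3 : ℝ) * T ^ (2 / 3 : ℝ))))
        ≤ minEnergy1d lam T ∧
      minEnergy1d lam T
        ≤ ENNReal.ofReal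
            (C * (T + min (T ^ (1 / 3 : ℝ)) (lam ^ (1 / 3 : ℝ) * T ^ (2 / 3 : ℝ))))) :=
  ⟨⟨1 / 12, 4, by norm_num, by norm_num, fun _ _ _ hΦ hT hl => irrigationCost_bounds hΦ hT hl⟩,
    ⟨1 / 10, 10, by norm_num, by norm_num, fun _ _ hT hl =>
      ⟨le_minEnergy1d hT hl, minEnergy1d_le hT hl⟩⟩⟩
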